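/- **Theorem 4.2.** Let $N\ge 1$ be an integer, let $\theta>0$ be real, and let $\mathbb C_N=\mathbb C[x_1,\dots,x_N]$, on which the symmetric group $S_N$ acts by permuting the variables. For $1\le i\le N$ let $$D_i=\frac{\partial}{\partial x_i}+\theta\sum_{j\ne i}\frac{1-(i,j)}{x_i-x_j}$$ be the Dunkl operator, where $(i,j)$ interchanges $x_i$ and $x_j$, and for $m\ge 1$ let $P_m=\sum_{i=1}^N (x_iD_i)^m$, where $x_i$ denotes multiplication by $x_i$. For an exponent sequence $\gamma=(\gamma_1,\dots,\gamma_N)\in\mathbb Z_{\ge 0}^N$ let $\gamma^+$ be its nonincreasing rearrangement. For partitions $\lambda=(\lambda_1\ge\dots\ge\lambda_N\ge 0)$ and $\mu=(\mu_1\ge\dots\ge\mu_N\ge 0)$ write $|\lambda|=\sum_i\lambda_i$, and $\mu\preceq\lambda$ if $|\mu|=|\lambda|$ and $\mu_1+\dots+\mu_k\le\lambda_1+\dots+\lambda_k$ for all $1\le k\le N$. Let $V_\lambda\subset\mathbb C_N$ be the span of the monomials $x^\gamma$ with $\gamma^+=\lambda$; it is a representation of $S_N$. For an irreducible complex representation $\tau$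 of $S_N$, considered up to isomorphism (these isomorphism classes are parametrized by the partitions $\tau\vdash N$), let $V_{\lambda;\tau}$ be the $\tau$-isotypic component of $V_\lambda$. Then one can choose, for each triplet $(\lambda,\tau,i)$ with $\lambda=(\lambda_1\ge\dots\ge\lambda_N\ge 0)$, $\tau$ an isomorphism class of irreducible representations of $S_N$, and $1\le i\le\dim V_{\lambda;\tau}$, a nonzero polynomial $F_{\lambda,\tau,i}\in\mathbb C_N$ which is an eigenfunction of all the operators $P_m$, $m\ge 1$, such that: 1. $F_{\lambda,\tau,i}$ is homogeneous of degree $|\lambda|$. 2. All monomials $x^\gamma$ with nonzero coefficient in $F_{\lambda,\tau,i}$ satisfy $\gamma^+\preceq\lambda$. 3. The part of $F_{\lambda,\tau,i}$ spanned by the monomials in $V_\lambda$ belongs to $V_{\lambda;\tau}$. The functions $F_{\lambda,\tau,i}$ form a linear basis of $\mathbb C_N$. There are no other polynomial eigenfunctions, up to taking linear combinations within an eigenspace: if a nonzero $G\in\mathbb C_N$ satisfies $P_mG=c_mG$ for all $m\ge 1$, then $G$ is a linear combination of those $F_{\lambda,\tau,i}$ that satisfy $P_mF_{\lambda,\tau,i}=c_mF_{\lambda,\tau,i}$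 for all $m\ge1$; and for each single $m\ge 1$, if $P_mG=cG$, then $G$ is a linear combination of those $F_{\lambda,\tau,i}$ with $P_mF_{\lambda,\tau,i}=cF_{\lambda,\tau,i}$. -/

import Mathlib

open scoped MonoidAlgebra

noncomputable section

namespace HeckmanPolychronakos

open MvPolynomial

/-- The ring `ℂ[x_1, …, x_N]`. -/
abbrev Poly (N : ℕ) : Type := MvPolynomial (Fin N) ℂ

/-! ### The symmetric group permuting the variables -/

/-- The representation of the symmetric group on polynomials which permutes the variables,
`σ x_i = x_{σ i}`. -/
def permRep (N : ℕ) : Representation ℂ (Equiv.Perm (Fin N)) (Poly N) where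
  toFun σ := (rename σ : Poly N →ₐ[ℂ] Poly N).toLinearMap
  map_one' := by
    refine LinearMap.ext fun f => ?_
    simp [Equiv.Perm.coe_one]
  map_mul' σ τ := by
    refine LinearMap.ext fun f => ?_
    simp [rename_rename, Equiv.Perm.coe_mul]

theorem permRep_apply {N : ℕ} (σ : Equiv.Perm (Fin N)) (f : Poly N) :
    permRep N σ f = rename σ f := rfl

/-! ### Dunkl and Heckman–Polychronakos operators -/

theorem X_sub_X_dvd {N : ℕ} (i j : Fin N) (f : Poly N) :
    (X i - X j : Poly N) ∣ f - permRep N (Equiv.swap i j) f := by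
  rw [← Ideal.mem_span_singleton, ← Ideal.Quotient.eq]
  have h : (Ideal.Quotient.mkₐ ℂ (Ideal.span {(X i - X j : Poly N)})) =
      (Ideal.Quotient.mkₐ ℂ (Ideal.span {(X i - X j : Poly N)})).comp
        (rename (Equiv.swap i j)) := by
    have hij : Ideal.Quotient.mk (Ideal.span {(X i - X j : Poly N)}) (X i) =
        Ideal.Quotient.mk (Ideal.span {(X i - X j : Poly N)}) (X j) := by
      rw [Ideal.Quotient.eq]
      exact Ideal.mem_span_singleton_self _
    ext k
    simp only [Ideal.Quotient.mkₐ_eq_mk, AlgHom.comp_apply, rename_X]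
    rcases eq_or_ne k i with rfl | hki
    · simpa using hij
    · rcases eq_or_ne k j with rfl | hkj
      · simpa using hij.symm
      · rw [Equiv.swap_apply_of_ne_of_ne hki hkj]
  exact DFunLike.congr_fun h f

theorem X_sub_X_ne_zero {N : ℕ} {i j : Fin N} (h : i ≠ j) : (X i - X j : Poly N) ≠ 0 :=
  sub_ne_zero.2 fun h' => h (X_injective h')

/-- The operator `(1 - (i,j)) / (x_i - x_j)` on polynomials, for `i ≠ j`: its value at `f` is the
unique polynomial `q` with `f - (i,j) f = (x_i - x_j) q`. -/
def divDiff {N : ℕ} {i j : Fin N} (h : i ≠ j) : Poly N →ₗ[ℂ] Poly N where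
  toFun f := (X_sub_X_dvd i j f).choose
  map_add' f g := by
    apply mul_left_cancel₀ (X_sub_X_ne_zero h)
    rw [mul_add, ← (X_sub_X_dvd i j (f + g)).choose_spec, ← (X_sub_X_dvd i j f).choose_spec,
      ← (X_sub_X_dvd i j g).choose_spec, map_add]
    ring
  map_smul' c f := by
    apply mul_left_cancel₀ (X_sub_X_ne_zero h)
    rw [RingHom.id_apply, mul_smul_comm, ← (X_sub_X_dvd i j (c • f)).choose_spec,
      ← (X_sub_X_dvd i j f).choose_spec, map_smul, smul_sub]

theorem divDiff_spec {N : ℕ} {i j : Fin N} (h : i ≠ j) (f : Poly N) :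
    f - permRep N (Equiv.swap i j) f = (X i - X j) * divDiff h f :=
  (X_sub_X_dvd i j f).choose_spec

/-- The Dunkl operator `D_i = ∂/∂x_i + θ ∑_{j ≠ i} (1 - (i,j)) / (x_i - x_j)`. -/
def dunkl {N : ℕ} (θ : ℝ) (i : Fin N) : Poly N →ₗ[ℂ] Poly N :=
  (pderiv i).toLinearMap + (θ : ℂ) • ∑ j : {j : Fin N // i ≠ j}, divDiff j.2

/-- The operator `x_i D_i`. -/
def xDunkl {N : ℕ} (θ : ℝ) (i : Fin N) : Module.End ℂ (Poly N) :=
  LinearMap.mulLeft ℂ (X i) ∘ₗ dunkl θ i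

/-- The Heckman–Polychronakos operator `P_m = ∑_i (x_i D_i)^m`. -/
def hpOp (N : ℕ) (θ : ℝ) (m : ℕ) : Module.End ℂ (Poly N) :=
  ∑ i : Fin N, xDunkl θ i ^ m

/-! ### Partitions with at most `N` parts and the dominance order -/

/-- Partitions `λ_1 ≥ … ≥ λ_N ≥ 0` of length at most `N`. -/
abbrev PartLE (N : ℕ) : Type := {l : Fin N → ℕ // Antitone l}

/-- `|λ| = λ_1 + … + λ_N`. -/
def PartLE.size {N : ℕ} (l : PartLE N) : ℕ := ∑ i, l.1 i

/-- The (reflexive) dominance order `μ ⪯ λ`. -/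
def DomLE {N : ℕ} (μ l : PartLE N) : Prop :=
  μ.size = l.size ∧ ∀ k : Fin N, ∑ i ∈ Finset.Iic k, μ.1 i ≤ ∑ i ∈ Finset.Iic k, l.1 i

/-- `γ^+`: the nonincreasing rearrangement of the exponent sequence `γ`. -/
def sortDesc {N : ℕ} (γ : Fin N →₀ ℕ) : PartLE N :=
  ⟨γ ∘ Tuple.sort (OrderDual.toDual ∘ γ), Tuple.monotone_sort (OrderDual.toDual ∘ γ)⟩

theorem sortDesc_mapDomain {N : ℕ} (σ : Equiv.Perm (Fin N)) (γ : Fin N →₀ ℕ) :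
    sortDesc (γ.mapDomain σ) = sortDesc γ := by
  have h : (γ.mapDomain σ : Fin N → ℕ) = γ ∘ σ.symm := by
    ext a
    simp [Finsupp.mapDomain_equiv_apply]
  apply Subtype.ext
  have := Tuple.comp_perm_comp_sort_eq_comp_sort (f := OrderDual.toDual ∘ γ) (σ := σ.symm)
  simp only [sortDesc, h]
  exact this

/-- `V_λ`, the span of the monomials `x^γ` with `γ^+ = λ`. -/
def V {N : ℕ} (l : PartLE N) : Submodule ℂ (Poly N) :=
  Submodule.span ℂ {f | ∃ γ : Fin N →₀ ℕ, sortDesc γ = l ∧ f = monomial γ 1}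

/-- `V_λ` as a subrepresentation of the polynomial representation of the symmetric group. -/
def VRep {N : ℕ} (l : PartLE N) : Subrepresentation (permRep N) where
  toSubmodule := V l
  apply_mem_toSubmodule σ f hf := by
    refine (Submodule.span_le.2 ?_ : V l ≤ (V l).comap (permRep N σ)) hf
    rintro _ ⟨γ, hγ, rfl⟩
    refine Submodule.subset_span ⟨γ.mapDomain σ, ?_, ?_⟩
    · rw [sortDesc_mapDomain, hγ]
    · rw [permRep_apply, rename_monomial]

/-- The part of the polynomial `f` spanned by monomials in `V_λ`. -/
def partIn {N : ℕ} (l : PartLE N) (f : Poly N) : Poly N :=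
  ∑ γ ∈ f.support with sortDesc γ = l, monomial γ (f.coeff γ)

/-! ### Irreducible representations of the symmetric group and isotypic components -/

/-- An irreducible complex representation of the symmetric group `S_N`. -/
structure Irrep (N : ℕ) : Type 1 where
  carrier : Type
  [addCommGroup : AddCommGroup carrier]
  [module : Module ℂ carrier]
  rep : Representation ℂ (Equiv.Perm (Fin N)) carrier
  irreducible : rep.IsIrreducible

attribute [instance] Irrep.addCommGroup Irrep.module

/-- Isomorphism of irreducible representations. -/
instance Irrep.setoid (N : ℕ) : Setoid (Irrep N) where
  r S T := Nonempty (S.rep.Equiv T.rep)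
  iseqv :=
    { refl := fun S => ⟨Representation.Equiv.refl S.rep⟩
      symm := fun ⟨e⟩ => ⟨e.symm⟩
      trans := fun ⟨e⟩ ⟨f⟩ => ⟨e.trans f⟩ }

/-- Isomorphism classes of irreducible complex representations of `S_N`. -/
def IrrepClass (N : ℕ) : Type 1 := Quotient (Irrep.setoid N)

/-- `V_{λ;τ}`, the isotypic component of `τ` in `V_λ`: the sum of all subrepresentations of `V_λ`
that are isomorphic to a representation in the class `τ`. -/
def isotypic {N : ℕ} (l : PartLE N) (τ : IrrepClass N) : Submodule ℂ (Poly N) :=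
  (Subrepresentation.ofSubmodule'
    (isotypicComponent ℂ[Equiv.Perm (Fin N)] (VRep l).toRepresentation.asModule
      (Quotient.out τ).rep.asModule)).toSubmodule.map (V l).subtype

/-- The triplets `(λ, τ, i)` with `1 ≤ i ≤ dim V_{λ;τ}`. -/
structure Label (N : ℕ) : Type 1 where
  part : PartLE N
  irr : IrrepClass N
  idx : Fin (Module.finrank ℂ (isotypic part irr))

end HeckmanPolychronakos

end

/-!
The Dunkl operators commute, and `x_i D_i` is symmetric for the Dunkl form `⟨f, g⟩ = (f̄(D) g)(0)`,
which is positive definite for `θ ≥ 0`. Hence the operators `P_m` are commuting, `S_N`-equivariant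
and symmetric for a Hermitian inner product. They also preserve the span of the monomials `x^γ`
with `γ⁺ ⪯ λ`, and its subspace where `γ⁺ ≠ λ`. On the orthogonal complement of the latter in the
former they can be diagonalised simultaneously; by equivariance this can be done so that the parts
in `V_λ` of the eigenfunctions run through bases of the isotypic components of `V_λ`. Since each
eigenfunction differs from its part in `V_λ` by lower monomials, the eigenfunctions form a basis of
all polynomials, and expanding an arbitrary eigenfunction in this basis shows that only basis
elements with the same eigenvalues occur.
-/

open scoped MonoidAlgebra

noncomputable section

namespace HeckmanPolychronakos

open MvPolynomial

variable {N : ℕ}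

/-! ### Commutation relations of Dunkl operators -/

theorem permRep_X_mul (σ : Equiv.Perm (Fin N)) (i : Fin N) (f : Poly N) :
    permRep N σ (X i * f) = X (σ i) * permRep N σ f := by
  simp [permRep_apply]

theorem permRep_mul_apply (σ τ : Equiv.Perm (Fin N)) (f : Poly N) :
    permRep N (σ * τ) f = permRep N σ (permRep N τ f) := by
  rw [map_mul, Module.End.mul_apply]

theorem permRep_swap_self (i j : Fin N) (f : Poly N) :
    permRep N (Equiv.swap i j) (permRep N (Equiv.swap i j) f) = f := by
  rw [← permRep_mul_apply, Equiv.swap_mul_self, map_one, Module.End.one_apply]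

theorem permRep_permRep_swap (σ : Equiv.Perm (Fin N)) (i j : Fin N) (f : Poly N) :
    permRep N σ (permRep N (Equiv.swap i j) f) =
      permRep N (Equiv.swap (σ i) (σ j)) (permRep N σ f) := by
  rw [← permRep_mul_apply, ← permRep_mul_apply, Equiv.mul_swap_eq_swap_mul]

theorem divDiff_eq_of_eq_mul {i j : Fin N} (h : i ≠ j) {f q : Poly N}
    (hq : f - permRep N (Equiv.swap i j) f = (X i - X j) * q) : divDiff h f = q :=
  mul_left_cancel₀ (X_sub_X_ne_zero h) ((divDiff_spec h f).symm.trans hq)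

theorem permRep_divDiff (σ : Equiv.Perm (Fin N)) {i j : Fin N} (h : i ≠ j) (f : Poly N) :
    permRep N σ (divDiff h f) = divDiff (σ.injective.ne h) (permRep N σ f) := by
  symm
  apply divDiff_eq_of_eq_mul
  rw [← permRep_permRep_swap, ← map_sub, divDiff_spec h, sub_mul, map_sub, permRep_X_mul,
    permRep_X_mul, sub_mul]

theorem dunkl_apply (θ : ℝ) (i : Fin N) (f : Poly N) :
    dunkl θ i f = pderiv i f + (θ : ℂ) • ∑ j : {j : Fin N // i ≠ j}, divDiff j.2 f := by
  simp [dunkl]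

theorem xDunkl_apply (θ : ℝ) (i : Fin N) (f : Poly N) :
    xDunkl θ i f = X i * dunkl θ i f := rfl

theorem permRep_dunkl (θ : ℝ) (σ : Equiv.Perm (Fin N)) (i : Fin N) (f : Poly N) :
    permRep N σ (dunkl θ i f) = dunkl θ (σ i) (permRep N σ f) := by
  rw [dunkl_apply, dunkl_apply, map_add, map_smul, map_sum]
  congr 1
  · rw [permRep_apply, permRep_apply, pderiv_rename σ.injective]
  · simp_rw [permRep_divDiff]
    congr 1
    exact Fintype.sum_equiv (σ.subtypeEquiv fun a => (σ.injective.ne_iff).symm) _ _ fun _ => rfl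

theorem permRep_xDunkl (θ : ℝ) (σ : Equiv.Perm (Fin N)) (i : Fin N) (f : Poly N) :
    permRep N σ (xDunkl θ i f) = xDunkl θ (σ i) (permRep N σ f) := by
  rw [xDunkl_apply, permRep_X_mul, permRep_dunkl, xDunkl_apply]

/-- The commutator `[D_i, x_j]`, see `dunkl_X_mul`; it lies in the group algebra of `S_N`. -/
def dunklXComm (θ : ℝ) (i j : Fin N) : Poly N →ₗ[ℂ] Poly N :=
  if i = j then 1 + (θ : ℂ) • ∑ k : {k : Fin N // i ≠ k}, permRep N (Equiv.swap i k.1)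
  else -((θ : ℂ) • permRep N (Equiv.swap i j))

theorem dunklXComm_self (θ : ℝ) (i : Fin N) (f : Poly N) :
    dunklXComm θ i i f =
      f + (θ : ℂ) • ∑ k : {k : Fin N // i ≠ k}, permRep N (Equiv.swap i k.1) f := by
  simp [dunklXComm]

theorem dunklXComm_of_ne (θ : ℝ) {i j : Fin N} (h : i ≠ j) (f : Poly N) :
    dunklXComm θ i j f = -((θ : ℂ) • permRep N (Equiv.swap i j) f) := by
  simp [dunklXComm, h]

theorem dunklXComm_comm (θ : ℝ) (i j : Fin N) : dunklXComm θ i j = dunklXComm θ j i := by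
  rcases eq_or_ne i j with rfl | h
  · rfl
  · simp [dunklXComm, h, h.symm, Equiv.swap_comm]

theorem divDiff_X_mul_left {i j : Fin N} (h : i ≠ j) (f : Poly N) :
    divDiff h (X i * f) = X i * divDiff h f + permRep N (Equiv.swap i j) f := by
  apply divDiff_eq_of_eq_mul
  rw [permRep_X_mul, Equiv.swap_apply_left]
  linear_combination X i * divDiff_spec h f

theorem divDiff_X_mul_right {i j : Fin N} (h : i ≠ j) (f : Poly N) :
    divDiff h (X j * f) = X j * divDiff h f - permRep N (Equiv.swap i j) f := by
  apply divDiff_eq_of_eq_mul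
  rw [permRep_X_mul, Equiv.swap_apply_right]
  linear_combination X j * divDiff_spec h f

theorem divDiff_X_mul_of_ne {i j k : Fin N} (h : i ≠ j) (hi : k ≠ i) (hj : k ≠ j) (f : Poly N) :
    divDiff h (X k * f) = X k * divDiff h f := by
  apply divDiff_eq_of_eq_mul
  rw [permRep_X_mul, Equiv.swap_apply_of_ne_of_ne hi hj]
  linear_combination X k * divDiff_spec h f

theorem dunkl_X_mul (θ : ℝ) (i j : Fin N) (f : Poly N) :
    dunkl θ i (X j * f) = X j * dunkl θ i f + dunklXComm θ i j f := by
  rw [dunkl_apply, dunkl_apply, Derivation.leibniz, pderiv_X]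
  rcases eq_or_ne i j with rfl | h
  · simp_rw [divDiff_X_mul_left, dunklXComm_self, Finset.sum_add_distrib, ← Finset.mul_sum,
      Pi.single_eq_same, smul_add, mul_add, smul_eq_mul, mul_smul_comm]
    ring
  · have hs : ∑ k : {k : Fin N // i ≠ k}, divDiff k.2 (X j * f) =
        X j * ∑ k : {k : Fin N // i ≠ k}, divDiff k.2 f - permRep N (Equiv.swap i j) f := by
      rw [eq_sub_iff_add_eq', ← eq_sub_iff_add_eq, Finset.mul_sum,
        ← Finset.sum_sub_distrib, Fintype.sum_eq_single ⟨j, h⟩, divDiff_X_mul_right]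
      · ring
      · rintro ⟨k, hk⟩ hkj
        rw [divDiff_X_mul_of_ne hk h.symm (fun h' => hkj (Subtype.ext h'.symm)), sub_self]
    rw [hs, dunklXComm_of_ne θ h, Pi.single_eq_of_ne h.symm]
    simp only [smul_sub, mul_add, smul_eq_mul, mul_smul_comm, mul_zero]
    ring

theorem dunkl_C (θ : ℝ) (i : Fin N) (c : ℂ) : dunkl θ i (C c) = 0 := by
  have h : ∀ j : {j : Fin N // i ≠ j}, divDiff j.2 (C c : Poly N) = 0 := fun j =>
    divDiff_eq_of_eq_mul _ (by simp [permRep_apply])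
  simp [dunkl_apply, h]

theorem dunklXComm_dunkl_symm_of_eq (θ : ℝ) {i j : Fin N} (hij : i ≠ j) (f : Poly N) :
    dunklXComm θ i i (dunkl θ j f) + dunkl θ i (dunklXComm θ j i f) =
      dunklXComm θ j i (dunkl θ i f) + dunkl θ j (dunklXComm θ i i f) := by
  have key : ∑ k : {k : Fin N // i ≠ k}, permRep N (Equiv.swap i k.1) (dunkl θ j f) -
      ∑ k : {k : Fin N // i ≠ k}, dunkl θ j (permRep N (Equiv.swap i k.1) f) =
      permRep N (Equiv.swap i j) (dunkl θ j f) - permRep N (Equiv.swap i j) (dunkl θ i f) := by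
    rw [← Finset.sum_sub_distrib, Fintype.sum_eq_single ⟨j, hij⟩]
    · simp [permRep_dunkl]
    · rintro ⟨k, hk⟩ hkj
      have hjk : j ≠ k := fun h' => hkj (Subtype.ext h'.symm)
      rw [permRep_dunkl, Equiv.swap_apply_of_ne_of_ne hij.symm hjk, sub_self]
  rw [dunklXComm_self, dunklXComm_self, dunklXComm_of_ne θ hij.symm, dunklXComm_of_ne θ hij.symm,
    map_add, map_smul, map_sum, map_neg, map_smul, Equiv.swap_comm j i]
  have h1 : dunkl θ i (permRep N (Equiv.swap i j) f) =
      permRep N (Equiv.swap i j) (dunkl θ j f) := by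
    rw [permRep_dunkl, Equiv.swap_apply_right]
  rw [h1]
  have := congrArg ((θ : ℂ) • ·) key
  simp only [smul_sub] at this
  linear_combination this

-- In other words, `[D_i, D_j]` commutes with `x_k`.
theorem dunklXComm_dunkl_symm (θ : ℝ) (i j k : Fin N) (f : Poly N) :
    dunklXComm θ i k (dunkl θ j f) + dunkl θ i (dunklXComm θ j k f) =
      dunklXComm θ j k (dunkl θ i f) + dunkl θ j (dunklXComm θ i k f) := by
  rcases eq_or_ne i j with rfl | hij
  · rfl
  rcases eq_or_ne k i with rfl | hki
  · exact dunklXComm_dunkl_symm_of_eq θ hij f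
  rcases eq_or_ne k j with rfl | hkj
  · exact (dunklXComm_dunkl_symm_of_eq θ hij.symm f).symm
  · rw [dunklXComm_of_ne θ hki.symm, dunklXComm_of_ne θ hki.symm, dunklXComm_of_ne θ hkj.symm,
      dunklXComm_of_ne θ hkj.symm, map_neg, map_neg, map_smul, map_smul, permRep_dunkl,
      permRep_dunkl, Equiv.swap_apply_of_ne_of_ne hij.symm hkj.symm,
      Equiv.swap_apply_of_ne_of_ne hij hki.symm]
    ring

theorem dunkl_comm (θ : ℝ) (i j : Fin N) (f : Poly N) :
    dunkl θ i (dunkl θ j f) = dunkl θ j (dunkl θ i f) := by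
  induction f using MvPolynomial.induction_on with
  | C a => simp [dunkl_C]
  | add p q hp hq => simp [hp, hq]
  | mul_X p k hp =>
    rw [mul_comm, dunkl_X_mul, dunkl_X_mul, map_add, map_add, dunkl_X_mul, dunkl_X_mul, hp]
    linear_combination dunklXComm_dunkl_symm θ i j k p

/-! ### The Heckman–Polychronakos operators commute -/

theorem permRep_swap_mul_xDunkl (θ : ℝ) (i j : Fin N) :
    permRep N (Equiv.swap i j) * xDunkl θ i = xDunkl θ j * permRep N (Equiv.swap i j) := by
  refine LinearMap.ext fun f => ?_
  simp only [Module.End.mul_apply]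
  rw [permRep_xDunkl, Equiv.swap_apply_left]

theorem xDunkl_mul_sub (θ : ℝ) {i j : Fin N} (h : i ≠ j) :
    xDunkl θ i * xDunkl θ j - xDunkl θ j * xDunkl θ i =
      (xDunkl θ j - xDunkl θ i) * ((θ : ℂ) • permRep N (Equiv.swap i j)) := by
  refine LinearMap.ext fun f => ?_
  simp only [Module.End.mul_apply, LinearMap.sub_apply, LinearMap.smul_apply, map_smul]
  simp only [xDunkl_apply, dunkl_X_mul, dunklXComm_of_ne θ h, dunklXComm_of_ne θ h.symm,
    permRep_dunkl, Equiv.swap_apply_left, Equiv.swap_apply_right, dunkl_comm θ i j,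
    Equiv.swap_comm j i, mul_add, mul_neg, mul_smul_comm, smul_sub]
  ring

section Ring

variable {R : Type*} [Ring R] {a b s : R}

theorem mul_pow_sub_pow_mul (hab : a * b - b * a = (b - a) * s) (hb : s * b = a * s) (k : ℕ) :
    a * b ^ k - b ^ k * a = (b ^ k - a ^ k) * s := by
  induction k with
  | zero => simp
  | succ k ih =>
    calc a * b ^ (k + 1) - b ^ (k + 1) * a
        = (a * b ^ k - b ^ k * a) * b + b ^ k * (a * b - b * a) := by
          rw [pow_succ]; noncomm_ring
      _ = (b ^ k - a ^ k) * (s * b) + b ^ k * ((b - a) * s) := by rw [ih, hab, mul_assoc]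
      _ = (b ^ (k + 1) - a ^ (k + 1)) * s := by
          rw [hb, pow_succ, pow_succ]; noncomm_ring

theorem sum_range_succ_pow_mul_pow (a b : R) (n m : ℕ) :
    ∑ r ∈ Finset.range (m + 1), a ^ r * b ^ (n - r) =
      a * ∑ r ∈ Finset.range m, a ^ r * b ^ (n - 1 - r) + b ^ n := by
  rw [Finset.sum_range_succ', Finset.mul_sum, pow_zero, one_mul, Nat.sub_zero]
  simp_rw [pow_succ' a, mul_assoc, Nat.sub_sub, add_comm]

-- The right-hand side is visibly symmetric in `p` and `k`.
theorem pow_mul_pow_sub_pow_mul_pow (hab : a * b - b * a = (b - a) * s) (ha : s * a = b * s)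
    (hb : s * b = a * s) (p k : ℕ) :
    a ^ p * b ^ k - b ^ k * a ^ p =
      ((∑ r ∈ Finset.range p, a ^ r * b ^ (p + k - 1 - r)) +
        (∑ r ∈ Finset.range k, a ^ r * b ^ (p + k - 1 - r)) -
        ∑ r ∈ Finset.range (p + k), a ^ r * b ^ (p + k - 1 - r)) * s := by
  induction p with
  | zero => simp
  | succ p ih =>
    have hs : s * a ^ p = b ^ p * s := SemiconjBy.pow_right ha p
    have hk : ∑ r ∈ Finset.range k, a ^ r * b ^ (p + k - r) + a ^ k * b ^ p =
        a * ∑ r ∈ Finset.range k, a ^ r * b ^ (p + k - 1 - r) + b ^ (p + k) := by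
      rw [← sum_range_succ_pow_mul_pow, Finset.sum_range_succ, Nat.add_sub_cancel]
    rw [show p + 1 + k - 1 = p + k by lia, show p + 1 + k = p + k + 1 by lia,
      sum_range_succ_pow_mul_pow, sum_range_succ_pow_mul_pow, eq_sub_of_add_eq hk]
    calc a ^ (p + 1) * b ^ k - b ^ k * a ^ (p + 1)
        = a * (a ^ p * b ^ k - b ^ k * a ^ p) + (a * b ^ k - b ^ k * a) * a ^ p := by
          rw [pow_succ']; noncomm_ring
      _ = _ := by
          rw [ih, mul_pow_sub_pow_mul hab hb, mul_assoc _ s, hs, add_comm p k, pow_add b k p]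
          noncomm_ring

theorem pow_commutator_symm (hab : a * b - b * a = (b - a) * s) (ha : s * a = b * s)
    (hb : s * b = a * s) (p k : ℕ) :
    a ^ p * b ^ k - b ^ k * a ^ p = a ^ k * b ^ p - b ^ p * a ^ k := by
  rw [pow_mul_pow_sub_pow_mul_pow hab ha hb p k, pow_mul_pow_sub_pow_mul_pow hab ha hb k p,
    add_comm k p, add_comm (∑ r ∈ Finset.range k, _)]

theorem commute_sum_sum [IsAddTorsionFree R] {ι : Type*} [Fintype ι] {x y : ι → R}
    (h : ∀ i j, x i * y j - y j * x i = y i * x j - x j * y i) :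
    Commute (∑ i, x i) (∑ i, y i) := by
  have h1 : (∑ i, x i) * (∑ i, y i) - (∑ i, y i) * (∑ i, x i) =
      (∑ i, y i) * (∑ i, x i) - (∑ i, x i) * (∑ i, y i) := by
    have h2 : ∑ i, ∑ j, (x i * y j - y j * x i) = ∑ i, ∑ j, (y i * x j - x j * y i) :=
      Finset.sum_congr rfl fun i _ => Finset.sum_congr rfl fun j _ => h i j
    simp only [Finset.sum_sub_distrib] at h2
    rw [Finset.sum_comm (f := fun i j => y j * x i),
      Finset.sum_comm (f := fun i j => x j * y i)] at h2
    simpa only [Finset.sum_mul_sum] using h2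
  exact sub_eq_zero.1 (self_eq_neg.1 (by rwa [neg_sub]))

end Ring

theorem xDunkl_pow_commutator_symm (θ : ℝ) (i j : Fin N) (p k : ℕ) :
    xDunkl θ i ^ p * xDunkl θ j ^ k - xDunkl θ j ^ k * xDunkl θ i ^ p =
      xDunkl θ i ^ k * xDunkl θ j ^ p - xDunkl θ j ^ p * xDunkl θ i ^ k := by
  rcases eq_or_ne i j with rfl | h
  · simp only [← pow_add, add_comm p k, sub_self]
  · refine pow_commutator_symm (xDunkl_mul_sub θ h) ?_ ?_ p k
    · rw [smul_mul_assoc, mul_smul_comm, permRep_swap_mul_xDunkl]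
    · rw [smul_mul_assoc, mul_smul_comm, Equiv.swap_comm, permRep_swap_mul_xDunkl]

theorem hpOp_commute (N : ℕ) (θ : ℝ) (m n : ℕ) : Commute (hpOp N θ m) (hpOp N θ n) :=
  have : IsAddTorsionFree (Module.End ℂ (Poly N)) := IsAddTorsionFree.of_isTorsionFree ℂ _
  commute_sum_sum fun i j => xDunkl_pow_commutator_symm θ i j m n

theorem permRep_hpOp (θ : ℝ) (m : ℕ) (σ : Equiv.Perm (Fin N)) (f : Poly N) :
    permRep N σ (hpOp N θ m f) = hpOp N θ m (permRep N σ f) := by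
  have h : ∀ i, permRep N σ ((xDunkl θ i ^ m) f) = (xDunkl θ (σ i) ^ m) (permRep N σ f) := by
    intro i
    induction m with
    | zero => simp
    | succ m ih => rw [pow_succ', pow_succ', Module.End.mul_apply, Module.End.mul_apply,
        permRep_xDunkl, ih]
  simp only [hpOp, LinearMap.sum_apply, map_sum, h]
  exact Fintype.sum_equiv σ _ _ fun _ => rfl

/-! ### The dominance order -/

theorem DomLE.refl (l : PartLE N) : DomLE l l := ⟨rfl, fun _ => le_rfl⟩

theorem DomLE.trans {l μ ν : PartLE N} (h : DomLE l μ) (h' : DomLE μ ν) : DomLE l ν :=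
  ⟨h.1.trans h'.1, fun k => (h.2 k).trans (h'.2 k)⟩

theorem eq_of_sum_Iic_eq {μ l : PartLE N}
    (h : ∀ k, ∑ i ∈ Finset.Iic k, μ.1 i = ∑ i ∈ Finset.Iic k, l.1 i) : μ = l := by
  apply Subtype.ext
  funext k
  induction k using WellFoundedLT.induction with
  | ind k ih =>
    have hs : ∑ i ∈ Finset.Iio k, μ.1 i = ∑ i ∈ Finset.Iio k, l.1 i :=
      Finset.sum_congr rfl fun i hi => ih i (Finset.mem_Iio.1 hi)
    have hk := h k
    rw [← Finset.Iio_insert k, Finset.sum_insert (by simp), Finset.sum_insert (by simp), hs] at hk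
    exact Nat.add_right_cancel hk

theorem DomLE.antisymm {μ l : PartLE N} (h : DomLE μ l) (h' : DomLE l μ) : μ = l :=
  eq_of_sum_Iic_eq fun k => (h.2 k).antisymm (h'.2 k)

/-- The sum of all partial sums of a partition, a strictly monotone rank function for the
dominance order. -/
def PartLE.rank (l : PartLE N) : ℕ := ∑ k, ∑ i ∈ Finset.Iic k, l.1 i

theorem DomLE.rank_lt {μ l : PartLE N} (h : DomLE μ l) (hne : μ ≠ l) : μ.rank < l.rank := by
  refine (Finset.sum_le_sum fun k _ => h.2 k).lt_of_ne fun h' => hne (eq_of_sum_Iic_eq fun k => ?_)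
  exact (Finset.sum_eq_sum_iff_of_le fun k _ => h.2 k).1 h' k (Finset.mem_univ k)

-- For `t = λ_k` the right-hand sum is `λ_1 + ⋯ + λ_k - k t`.
theorem domLE_of_sum_tsub_le {μ l : PartLE N} (hsize : μ.size = l.size)
    (h : ∀ t, ∑ i, (μ.1 i - t) ≤ ∑ i, (l.1 i - t)) : DomLE μ l := by
  refine ⟨hsize, fun k => ?_⟩
  set t := l.1 k
  calc ∑ i ∈ Finset.Iic k, μ.1 i
      ≤ ∑ i ∈ Finset.Iic k, (μ.1 i - t + t) := Finset.sum_le_sum fun _ _ => le_tsub_add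
    _ ≤ ∑ i, (l.1 i - t) + ∑ _i ∈ Finset.Iic k, t := by
        rw [Finset.sum_add_distrib]
        gcongr
        exact (Finset.sum_le_univ_sum_of_nonneg fun _ => Nat.zero_le _).trans (h t)
    _ = ∑ i ∈ Finset.Iic k, (l.1 i - t + t) := by
        rw [Finset.sum_add_distrib, add_left_inj]
        refine (Finset.sum_subset (Finset.subset_univ _) fun i _ hi => ?_).symm
        exact tsub_eq_zero_of_le (l.2 (not_le.1 fun h' => hi (Finset.mem_Iic.2 h')).le)
    _ = ∑ i ∈ Finset.Iic k, l.1 i :=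
        Finset.sum_congr rfl fun i hi => tsub_add_cancel_of_le (l.2 (Finset.mem_Iic.1 hi))

theorem sum_comp_sortDesc {M : Type*} [AddCommMonoid M] (φ : ℕ → M) (γ : Fin N →₀ ℕ) :
    ∑ i, φ ((sortDesc γ).1 i) = ∑ i, φ (γ i) :=
  Fintype.sum_equiv (Tuple.sort (OrderDual.toDual ∘ γ)) _ _ fun _ => rfl

theorem size_sortDesc (γ : Fin N →₀ ℕ) : (sortDesc γ).size = γ.degree :=
  (sum_comp_sortDesc id γ).trans (Finsupp.degree_eq_sum γ).symm

theorem sum_le_sum_of_two_point {ι M : Type*} [Fintype ι] [AddCommMonoid M] [PartialOrder M]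
    [IsOrderedAddMonoid M] {f g : ι → M} {i j : ι} (hij : i ≠ j)
    (hne : ∀ k, k ≠ i → k ≠ j → f k = g k) (h : f i + f j ≤ g i + g j) :
    ∑ k, f k ≤ ∑ k, g k := by
  classical
  rw [← Finset.sum_add_sum_compl {i, j} f, ← Finset.sum_add_sum_compl {i, j} g,
    Finset.sum_pair hij, Finset.sum_pair hij]
  refine add_le_add h (Finset.sum_le_sum fun k hk => ?_)
  simp only [Finset.mem_compl, Finset.mem_insert, Finset.mem_singleton, not_or] at hk
  exact (hne k hk.1 hk.2).le

theorem domLE_sortDesc_of_two_point {γ' γ : Fin N →₀ ℕ} {i j : Fin N} (hij : i ≠ j)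
    (hne : ∀ k, k ≠ i → k ≠ j → γ' k = γ k) (hadd : γ' i + γ' j = γ i + γ j)
    (hi : γ' i ≤ max (γ i) (γ j)) (hj : γ' j ≤ max (γ i) (γ j)) :
    DomLE (sortDesc γ') (sortDesc γ) := by
  refine domLE_of_sum_tsub_le ?_ fun t => ?_
  · rw [PartLE.size, PartLE.size, sum_comp_sortDesc fun n => n, sum_comp_sortDesc fun n => n]
    exact (sum_le_sum_of_two_point hij hne hadd.le).antisymm
      (sum_le_sum_of_two_point hij (fun k h h' => (hne k h h').symm) hadd.ge)
  · rw [sum_comp_sortDesc (· - t), sum_comp_sortDesc (· - t)]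
    exact sum_le_sum_of_two_point hij (fun k h h' => by rw [hne k h h']) (by lia)

/-! ### Triangularity -/

/-- The span of the monomials `x^γ` with `γ^+ ⪯ λ`. -/
def lowerSpan (l : PartLE N) : Submodule ℂ (Poly N) :=
  restrictSupport ℂ {γ | DomLE (sortDesc γ) l}

/-- The span of the monomials `x^γ` with `γ^+ ≺ λ`. -/
def strictLowerSpan (l : PartLE N) : Submodule ℂ (Poly N) :=
  restrictSupport ℂ {γ | DomLE (sortDesc γ) l ∧ sortDesc γ ≠ l}

theorem mem_lowerSpan {l : PartLE N} {f : Poly N} :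
    f ∈ lowerSpan l ↔ ∀ γ ∈ f.support, DomLE (sortDesc γ) l := Iff.rfl

theorem mem_strictLowerSpan {l : PartLE N} {f : Poly N} :
    f ∈ strictLowerSpan l ↔ ∀ γ ∈ f.support, DomLE (sortDesc γ) l ∧ sortDesc γ ≠ l := Iff.rfl

theorem monomial_mem_lowerSpan {l : PartLE N} {γ : Fin N →₀ ℕ} (h : DomLE (sortDesc γ) l) (a : ℂ) :
    monomial γ a ∈ lowerSpan l :=
  (monomial_mem_restrictSupport ℂ).2 (Or.inl h)

theorem strictLowerSpan_le_lowerSpan (l : PartLE N) : strictLowerSpan l ≤ lowerSpan l :=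
  restrictSupport_mono _ fun _ h => h.1

theorem lowerSpan_mono {μ l : PartLE N} (h : DomLE μ l) : lowerSpan μ ≤ lowerSpan l :=
  restrictSupport_mono _ fun _ hγ => DomLE.trans hγ h

theorem lowerSpan_le_strictLowerSpan {μ l : PartLE N} (h : DomLE μ l) (hne : μ ≠ l) :
    lowerSpan μ ≤ strictLowerSpan l :=
  restrictSupport_mono _ fun _ hγ => ⟨hγ.trans h, fun h' => hne (h.antisymm (h' ▸ hγ))⟩

theorem isHomogeneous_of_mem_lowerSpan {l : PartLE N} {f : Poly N} (hf : f ∈ lowerSpan l) :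
    f.IsHomogeneous l.size := by
  intro γ hγ
  rw [← (mem_lowerSpan.1 hf γ (mem_support_iff.2 hγ)).1, size_sortDesc,
    Finsupp.degree_eq_weight_one]
  rfl

instance finiteDimensional_lowerSpan (l : PartLE N) : FiniteDimensional ℂ (lowerSpan l) :=
  have : FiniteDimensional ℂ (homogeneousSubmodule (Fin N) ℂ l.size) :=
    Module.Finite.iff_fg.2 (homogeneousSubmodule_fg _ _ _)
  Submodule.finiteDimensional_of_le (S₂ := homogeneousSubmodule (Fin N) ℂ l.size)
    fun _ hf => isHomogeneous_of_mem_lowerSpan hf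

instance finiteDimensional_strictLowerSpan (l : PartLE N) :
    FiniteDimensional ℂ (strictLowerSpan l) :=
  Submodule.finiteDimensional_of_le (strictLowerSpan_le_lowerSpan l)

theorem permRep_monomial (σ : Equiv.Perm (Fin N)) (γ : Fin N →₀ ℕ) (a : ℂ) :
    permRep N σ (monomial γ a) = monomial (γ.mapDomain σ) a := by
  rw [permRep_apply, rename_monomial]

theorem permRep_swap_monomial_of_eq {i j : Fin N} {δ : Fin N →₀ ℕ} (h : δ i = δ j) (a : ℂ) :
    permRep N (Equiv.swap i j) (monomial δ a) = monomial δ a := by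
  rw [permRep_monomial]
  refine congrArg (fun δ => monomial δ a) (Finsupp.ext fun k => ?_)
  rw [Finsupp.mapDomain_equiv_apply, Equiv.symm_swap, Equiv.swap_apply_def]
  split_ifs with h1 h2
  · rw [h1, h]
  · rw [h2, h]
  · rfl

theorem divDiff_permRep_swap {i j : Fin N} (h : i ≠ j) (f : Poly N) :
    divDiff h (permRep N (Equiv.swap i j) f) = -divDiff h f := by
  apply divDiff_eq_of_eq_mul
  rw [permRep_swap_self, mul_neg, ← divDiff_spec, neg_sub]

theorem divDiff_monomial_add_single {i j : Fin N} (h : i ≠ j) {δ : Fin N →₀ ℕ} (hδ : δ i = δ j)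
    (c : ℕ) (a : ℂ) :
    divDiff h (monomial (δ + Finsupp.single i c) a) = ∑ k ∈ Finset.range c,
      monomial (δ + Finsupp.single i k + Finsupp.single j (c - 1 - k)) a := by
  apply divDiff_eq_of_eq_mul
  have hswap : permRep N (Equiv.swap i j) (monomial δ a * X i ^ c) = monomial δ a * X j ^ c := by
    conv_rhs => rw [← permRep_swap_monomial_of_eq hδ]
    simp [permRep_apply]
  simp_rw [monomial_add_single, hswap, mul_assoc, ← Finset.mul_sum]
  linear_combination -monomial δ a * geom_sum₂_mul (X i : Poly N) (X j) c

theorem X_mul_divDiff_monomial_mem_of_le {i j : Fin N} (hij : i ≠ j) {γ : Fin N →₀ ℕ}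
    (h : γ j ≤ γ i) (a : ℂ) : X i * divDiff hij (monomial γ a) ∈ lowerSpan (sortDesc γ) := by
  obtain ⟨δ, c, rfl, hδ⟩ : ∃ (δ : Fin N →₀ ℕ) (c : ℕ), δ + Finsupp.single i c = γ ∧ δ i = δ j := by
    refine ⟨γ - Finsupp.single i (γ i - γ j), γ i - γ j, tsub_add_cancel_of_le ?_, ?_⟩
    · exact Finsupp.single_le_iff.2 (Nat.sub_le _ _)
    · simp [hij, Nat.sub_sub_self h]
  rw [divDiff_monomial_add_single hij hδ, Finset.mul_sum]
  refine sum_mem fun k hk => ?_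
  have hk := Finset.mem_range.1 hk
  rw [X, monomial_mul, one_mul]
  refine monomial_mem_lowerSpan (domLE_sortDesc_of_two_point hij ?_ ?_ ?_ ?_) a
  · intro m hi hj
    simp [hi, hj]
  all_goals
    simp only [Finsupp.add_apply, Finsupp.single_apply, hij, hij.symm, hδ, if_true, if_false]
    lia

theorem X_mul_divDiff_monomial_mem {i j : Fin N} (hij : i ≠ j) (γ : Fin N →₀ ℕ) (a : ℂ) :
    X i * divDiff hij (monomial γ a) ∈ lowerSpan (sortDesc γ) := by
  rcases le_total (γ j) (γ i) with h | h
  · exact X_mul_divDiff_monomial_mem_of_le hij h a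
  · rw [← sortDesc_mapDomain (Equiv.swap i j), ← neg_neg (divDiff hij _), ← divDiff_permRep_swap,
      permRep_monomial, mul_neg]
    refine neg_mem (X_mul_divDiff_monomial_mem_of_le hij ?_ a)
    simpa [Finsupp.mapDomain_equiv_apply] using h

theorem xDunkl_monomial_mem (θ : ℝ) (i : Fin N) (γ : Fin N →₀ ℕ) (a : ℂ) :
    xDunkl θ i (monomial γ a) ∈ lowerSpan (sortDesc γ) := by
  rw [xDunkl_apply, dunkl_apply, mul_add, mul_smul_comm, Finset.mul_sum, X_mul_pderiv_monomial]
  refine add_mem ?_ (Submodule.smul_mem _ _ (sum_mem fun j _ => X_mul_divDiff_monomial_mem j.2 γ a))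
  exact Submodule.smul_of_tower_mem _ _ (monomial_mem_lowerSpan (DomLE.refl _) a)

theorem map_mem_of_monomial {R σ M : Type*} [CommSemiring R] [AddCommMonoid M] [Module R M]
    {T : MvPolynomial σ R →ₗ[R] M} {W : Submodule R M} {f : MvPolynomial σ R}
    (hT : ∀ γ ∈ f.support, ∀ a, T (monomial γ a) ∈ W) : T f ∈ W := by
  rw [f.as_sum, map_sum]
  exact sum_mem fun γ hγ => hT γ hγ _

theorem xDunkl_mem_lowerSpan (θ : ℝ) (i : Fin N) {l : PartLE N} {f : Poly N}
    (hf : f ∈ lowerSpan l) : xDunkl θ i f ∈ lowerSpan l :=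
  map_mem_of_monomial fun γ hγ a =>
    lowerSpan_mono (mem_lowerSpan.1 hf γ hγ) (xDunkl_monomial_mem θ i γ a)

theorem xDunkl_mem_strictLowerSpan (θ : ℝ) (i : Fin N) {l : PartLE N} {f : Poly N}
    (hf : f ∈ strictLowerSpan l) : xDunkl θ i f ∈ strictLowerSpan l :=
  map_mem_of_monomial fun γ hγ a =>
    have h := mem_strictLowerSpan.1 hf γ hγ
    lowerSpan_le_strictLowerSpan h.1 h.2 (xDunkl_monomial_mem θ i γ a)

theorem hpOp_mem (θ : ℝ) (m : ℕ) {W : Submodule ℂ (Poly N)}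
    (hW : ∀ i, ∀ f ∈ W, xDunkl θ i f ∈ W) {f : Poly N} (hf : f ∈ W) : hpOp N θ m f ∈ W := by
  rw [hpOp, LinearMap.sum_apply]
  exact sum_mem fun i _ => W.le_comap_pow_of_le_comap (hW i) m hf

theorem hpOp_mem_lowerSpan (θ : ℝ) (m : ℕ) {l : PartLE N} {f : Poly N}
    (hf : f ∈ lowerSpan l) : hpOp N θ m f ∈ lowerSpan l :=
  hpOp_mem θ m (fun i _ => xDunkl_mem_lowerSpan θ i) hf

theorem hpOp_mem_strictLowerSpan (θ : ℝ) (m : ℕ) {l : PartLE N} {f : Poly N}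
    (hf : f ∈ strictLowerSpan l) : hpOp N θ m f ∈ strictLowerSpan l :=
  hpOp_mem θ m (fun i _ => xDunkl_mem_strictLowerSpan θ i) hf

theorem isHomogeneous_xDunkl (θ : ℝ) (i : Fin N) {f : Poly N} {n : ℕ} (hf : f.IsHomogeneous n) :
    (xDunkl θ i f).IsHomogeneous n := by
  refine (mem_homogeneousSubmodule n _).1 (map_mem_of_monomial fun γ hγ a => ?_)
  have hdeg : γ.degree = n := by
    rw [Finsupp.degree_eq_weight_one]
    exact hf (mem_support_iff.1 hγ)
  rw [← hdeg, ← size_sortDesc]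
  exact isHomogeneous_of_mem_lowerSpan (xDunkl_monomial_mem θ i γ a)

theorem isHomogeneous_dunkl (θ : ℝ) (i : Fin N) {f : Poly N} {n : ℕ}
    (hf : f.IsHomogeneous (n + 1)) : (dunkl θ i f).IsHomogeneous n := by
  intro γ hγ
  have h : Finsupp.weight 1 (Finsupp.single i 1 + γ) = n + 1 :=
    isHomogeneous_xDunkl θ i hf (by rwa [xDunkl_apply, coeff_X_mul])
  rw [map_add, Finsupp.weight_single, add_comm] at h
  simpa using h

/-! ### The Dunkl form -/

open scoped IsMulCommutative in
/-- The substitution `f ↦ f(D_1, …, D_N)`, well defined since Dunkl operators commute. -/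
def dunklHom (N : ℕ) (θ : ℝ) : Poly N →ₐ[ℂ] Module.End ℂ (Poly N) :=
  have : IsMulCommutative (Algebra.adjoin ℂ (Set.range (dunkl (N := N) θ))) :=
    Algebra.isMulCommutative_adjoin ℂ (by
      rintro _ ⟨i, rfl⟩ _ ⟨j, rfl⟩
      exact LinearMap.ext (dunkl_comm θ i j))
  (Algebra.adjoin ℂ (Set.range (dunkl (N := N) θ))).val.comp
    (aeval fun i => ⟨dunkl θ i, Algebra.subset_adjoin ⟨i, rfl⟩⟩)

theorem dunklHom_X (θ : ℝ) (i : Fin N) : dunklHom N θ (X i) = dunkl θ i := by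
  simp [dunklHom]

/-- The sesquilinear form `⟨f, g⟩ = (f̄(D) g)(0)`, where `f̄` has the conjugate coefficients. -/
def dunklForm (θ : ℝ) : Poly N →ₗ⋆[ℂ] Poly N →ₗ[ℂ] ℂ where
  toFun f := lcoeff ℂ 0 ∘ₗ dunklHom N θ (map (starRingEnd ℂ) f)
  map_add' f g := by rw [map_add, map_add, LinearMap.comp_add]
  map_smul' c f := by
    rw [smul_eq_C_mul, map_mul, map_C, ← smul_eq_C_mul, map_smul, LinearMap.comp_smul]

theorem dunklForm_apply (θ : ℝ) (f g : Poly N) :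
    dunklForm θ f g = constantCoeff (dunklHom N θ (map (starRingEnd ℂ) f) g) := rfl

theorem dunklForm_C_left (θ : ℝ) (c : ℂ) (g : Poly N) :
    dunklForm θ (C c) g = starRingEnd ℂ c * constantCoeff g := by
  rw [dunklForm_apply, map_C, ← algebraMap_eq, AlgHom.commutes, Module.algebraMap_end_apply,
    smul_eq_C_mul, map_mul, constantCoeff_C]

theorem dunklForm_X_mul_left (θ : ℝ) (i : Fin N) (f g : Poly N) :
    dunklForm θ (X i * f) g = dunklForm θ f (dunkl θ i g) := by
  rw [dunklForm_apply, dunklForm_apply, mul_comm, map_mul, map_mul, map_X, dunklHom_X,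
    Module.End.mul_apply]

theorem dunklForm_permRep (θ : ℝ) (σ : Equiv.Perm (Fin N)) (f g : Poly N) :
    dunklForm θ (permRep N σ f) (permRep N σ g) = dunklForm θ f g := by
  induction f using MvPolynomial.induction_on generalizing g with
  | C a => simp [permRep_apply, dunklForm_C_left, constantCoeff_rename]
  | add p q hp hq => simp [hp, hq]
  | mul_X p k hp =>
    rw [mul_comm, permRep_X_mul, dunklForm_X_mul_left, dunklForm_X_mul_left, ← permRep_dunkl, hp]

theorem dunklForm_permRep_swap (θ : ℝ) (i j : Fin N) (f g : Poly N) :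
    dunklForm θ (permRep N (Equiv.swap i j) f) g =
      dunklForm θ f (permRep N (Equiv.swap i j) g) := by
  rw [← dunklForm_permRep θ (Equiv.swap i j), permRep_swap_self]

theorem dunklForm_dunklXComm (θ : ℝ) (i j : Fin N) (f g : Poly N) :
    dunklForm θ (dunklXComm θ i j f) g = dunklForm θ f (dunklXComm θ i j g) := by
  rcases eq_or_ne i j with rfl | h
  · simp [dunklXComm_self, dunklForm_permRep_swap, LinearMap.map_smulₛₗ, -Complex.coe_smul]
  · simp [dunklXComm_of_ne θ h, dunklForm_permRep_swap, LinearMap.map_smulₛₗ, -Complex.coe_smul]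

theorem dunklForm_X_mul_right (θ : ℝ) (i : Fin N) (f g : Poly N) :
    dunklForm θ f (X i * g) = dunklForm θ (dunkl θ i f) g := by
  induction f using MvPolynomial.induction_on generalizing i g with
  | C a => simp [dunklForm_C_left, dunkl_C]
  | add p q hp hq => simp [hp, hq]
  | mul_X p k hp =>
    rw [mul_comm, dunklForm_X_mul_left, dunkl_X_mul, dunkl_X_mul, map_add, map_add,
      LinearMap.add_apply, dunklForm_X_mul_left, dunklForm_dunklXComm, hp, dunklXComm_comm]

theorem dunklForm_C_right (θ : ℝ) (c : ℂ) (f : Poly N) :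
    dunklForm θ f (C c) = starRingEnd ℂ (constantCoeff f) * c := by
  induction f using MvPolynomial.induction_on with
  | C a => rw [dunklForm_C_left, constantCoeff_C, constantCoeff_C]
  | add p q hp hq => simp [hp, hq, add_mul]
  | mul_X p k _ => rw [mul_comm, dunklForm_X_mul_left, dunkl_C]; simp

theorem dunklForm_conj_symm (θ : ℝ) (f g : Poly N) :
    starRingEnd ℂ (dunklForm θ g f) = dunklForm θ f g := by
  induction f using MvPolynomial.induction_on generalizing g with
  | C a => rw [dunklForm_C_left, dunklForm_C_right, map_mul, Complex.conj_conj, mul_comm]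
  | add p q hp hq => simp [hp, hq]
  | mul_X p k hp => rw [mul_comm, dunklForm_X_mul_right, dunklForm_X_mul_left, hp]

theorem dunklForm_xDunkl (θ : ℝ) (i : Fin N) (f g : Poly N) :
    dunklForm θ (xDunkl θ i f) g = dunklForm θ f (xDunkl θ i g) := by
  rw [xDunkl_apply, xDunkl_apply, dunklForm_X_mul_left, dunklForm_X_mul_right]

theorem dunklForm_xDunkl_pow (θ : ℝ) (i : Fin N) (m : ℕ) (f g : Poly N) :
    dunklForm θ ((xDunkl θ i ^ m) f) g = dunklForm θ f ((xDunkl θ i ^ m) g) := by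
  induction m generalizing f with
  | zero => rfl
  | succ m ih =>
    rw [pow_succ, Module.End.mul_apply, ih, dunklForm_xDunkl, ← pow_succ, pow_succ',
      Module.End.mul_apply]

theorem dunklForm_hpOp (θ : ℝ) (m : ℕ) (f g : Poly N) :
    dunklForm θ (hpOp N θ m f) g = dunklForm θ f (hpOp N θ m g) := by
  simp only [hpOp, LinearMap.sum_apply, map_sum, dunklForm_xDunkl_pow]

/-! ### The Dunkl–Euler operator -/

/-- The operator `∑_i x_i D_i`, the analogue of the Euler operator `∑_i x_i ∂/∂x_i`. -/
def dunklEuler (N : ℕ) (θ : ℝ) : Module.End ℂ (Poly N) := ∑ i, xDunkl θ i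

theorem dunklEuler_apply (θ : ℝ) (f : Poly N) : dunklEuler N θ f = ∑ i, X i * dunkl θ i f := by
  simp [dunklEuler, xDunkl_apply]

theorem permRep_dunklEuler (θ : ℝ) (σ : Equiv.Perm (Fin N)) (f : Poly N) :
    permRep N σ (dunklEuler N θ f) = dunklEuler N θ (permRep N σ f) := by
  simp only [dunklEuler, LinearMap.sum_apply, map_sum, permRep_xDunkl]
  exact Fintype.sum_equiv σ _ _ fun _ => rfl

theorem isHomogeneous_dunklEuler (θ : ℝ) {n : ℕ} {f : Poly N} (hf : f.IsHomogeneous n) :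
    (dunklEuler N θ f).IsHomogeneous n := by
  rw [dunklEuler, LinearMap.sum_apply]
  exact IsHomogeneous.sum _ _ _ fun i _ => isHomogeneous_xDunkl θ i hf

theorem dunklForm_dunklEuler_left (θ : ℝ) (f g : Poly N) :
    dunklForm θ (dunklEuler N θ f) g = ∑ i, dunklForm θ (dunkl θ i f) (dunkl θ i g) := by
  simp only [dunklEuler_apply, map_sum, LinearMap.sum_apply, dunklForm_X_mul_left]

theorem dunklForm_dunklEuler (θ : ℝ) (f g : Poly N) :
    dunklForm θ (dunklEuler N θ f) g = dunklForm θ f (dunklEuler N θ g) := by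
  simp only [dunklEuler, LinearMap.sum_apply, map_sum, dunklForm_xDunkl]

theorem X_mul_divDiff_add {i j : Fin N} (h : i ≠ j) (f : Poly N) :
    X i * divDiff h f + X j * divDiff h.symm f = f - permRep N (Equiv.swap i j) f := by
  have hsymm : divDiff h.symm f = -divDiff h f := by
    apply divDiff_eq_of_eq_mul
    rw [Equiv.swap_comm, divDiff_spec h]
    ring
  rw [hsymm, divDiff_spec h]
  ring

theorem two_smul_sum_X_mul_divDiff (f : Poly N) :
    (2 : ℂ) • ∑ i, ∑ j : {j : Fin N // i ≠ j}, X i * divDiff j.2 f =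
      ∑ p : Fin N × Fin N, (f - permRep N (Equiv.swap p.1 p.2) f) := by
  have hext : ∀ i : Fin N, ∑ j : {j : Fin N // i ≠ j}, X i * divDiff j.2 f =
      ∑ j, if h : i ≠ j then X i * divDiff h f else 0 := fun i => by
    rw [Finset.sum_dite, Finset.sum_const_zero, add_zero]
    exact Fintype.sum_equiv (Equiv.subtypeEquivRight (by simp)) _ _ fun _ => rfl
  simp_rw [hext, Fintype.sum_prod_type]
  rw [two_smul]
  nth_rewrite 2 [Finset.sum_comm]
  simp_rw [← Finset.sum_add_distrib]
  refine Finset.sum_congr rfl fun i _ => Finset.sum_congr rfl fun j _ => ?_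
  rcases eq_or_ne i j with rfl | h
  · simp [← Equiv.Perm.one_def]
  · rw [dif_pos h, dif_pos h.symm, X_mul_divDiff_add]

theorem dunklEuler_eq (θ : ℝ) {n : ℕ} {f : Poly N} (hf : f.IsHomogeneous n) :
    dunklEuler N θ f = (n : ℂ) • f +
      ((θ / 2 : ℝ) : ℂ) • ∑ p : Fin N × Fin N, (f - permRep N (Equiv.swap p.1 p.2) f) := by
  simp_rw [dunklEuler_apply, dunkl_apply, mul_add, Finset.sum_add_distrib, mul_smul_comm,
    ← Finset.smul_sum, Finset.mul_sum]
  rw [hf.sum_X_mul_pderiv, ← two_smul_sum_X_mul_divDiff, smul_smul, Nat.cast_smul_eq_nsmul]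
  push_cast
  rw [div_mul_cancel₀ _ two_ne_zero]

-- On degree `n`, multiplication by `n` is the combination of self-adjoint operators in
-- `dunklEuler_eq`.
theorem dunklForm_eq_zero_of_ne (θ : ℝ) {n m : ℕ} (hnm : n ≠ m) {f g : Poly N}
    (hf : f.IsHomogeneous n) (hg : g.IsHomogeneous m) : dunklForm θ f g = 0 := by
  have h := dunklForm_dunklEuler θ f g
  rw [dunklEuler_eq θ hf, dunklEuler_eq θ hg] at h
  simp only [map_add, LinearMap.map_smulₛₗ, map_sum, map_sub, LinearMap.add_apply,
    LinearMap.smul_apply, LinearMap.sum_apply, LinearMap.sub_apply, dunklForm_permRep_swap,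
    Complex.conj_ofReal, map_natCast, RingHom.id_apply, smul_eq_mul, add_left_inj] at h
  have hnm' : (n - m : ℂ) ≠ 0 := sub_ne_zero.2 (Nat.cast_injective.ne hnm)
  exact (mul_eq_zero_iff_left hnm').1 (by linear_combination h)

/-! ### Positivity -/

theorem exists_norm_coeff_max {σ R : Type*} [NormedCommRing R] (f : MvPolynomial σ R) :
    ∃ γ, ∀ δ, ‖coeff δ f‖ ≤ ‖coeff γ f‖ := by
  rcases eq_or_ne f 0 with rfl | h
  · simp
  · obtain ⟨γ, _, hγ⟩ :=
      f.support.exists_max_image (fun δ => ‖coeff δ f‖) (support_nonempty.2 h)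
    refine ⟨γ, fun δ => ?_⟩
    by_cases hδ : δ ∈ f.support
    · exact hγ δ hδ
    · rw [notMem_support_iff.1 hδ, norm_zero]
      exact norm_nonneg _

theorem coeff_permRep (σ : Equiv.Perm (Fin N)) (f : Poly N) (γ : Fin N →₀ ℕ) :
    coeff γ (permRep N σ f) = coeff (γ.mapDomain σ.symm) f := by
  have hγ : (γ.mapDomain σ.symm).mapDomain σ = γ := by
    rw [← Finsupp.mapDomain_comp, Equiv.self_comp_symm, Finsupp.mapDomain_id]
  conv_lhs => rw [permRep_apply, ← hγ, coeff_rename_mapDomain _ σ.injective]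

-- Compare the coefficients of maximal absolute value on both sides.
theorem eq_zero_of_smul_eq_smul_sum_permRep {ι : Type*} [Fintype ι] {a b : ℂ}
    (hab : ‖b‖ * Fintype.card ι < ‖a‖) {f : Poly N} (σ : ι → Equiv.Perm (Fin N))
    (h : a • f = b • ∑ k, permRep N (σ k) f) : f = 0 := by
  obtain ⟨γ, hγ⟩ := exists_norm_coeff_max f
  have hle : ‖a‖ * ‖coeff γ f‖ ≤ ‖b‖ * Fintype.card ι * ‖coeff γ f‖ :=
    calc ‖a‖ * ‖coeff γ f‖ = ‖b‖ * ‖∑ k, coeff (γ.mapDomain (σ k).symm) f‖ := by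
          have h' := congrArg (fun p => ‖coeff γ p‖) h
          simpa only [coeff_smul, coeff_sum, coeff_permRep, smul_eq_mul, norm_mul] using h'
      _ ≤ ‖b‖ * ∑ _k : ι, ‖coeff γ f‖ := by
          gcongr
          exact norm_sum_le_of_le _ fun k _ => hγ _
      _ = ‖b‖ * Fintype.card ι * ‖coeff γ f‖ := by simp [mul_assoc]
  have hzero : ‖coeff γ f‖ ≤ 0 := by
    by_contra! hpos
    exact hle.not_gt (mul_lt_mul_of_pos_right hab hpos)
  ext δ
  rw [coeff_zero, ← norm_le_zero_iff]
  exact (hγ δ).trans hzero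

theorem eq_zero_of_dunklEuler_eq_zero {θ : ℝ} (hθ : 0 ≤ θ) {n : ℕ} (hn : n ≠ 0) {f : Poly N}
    (hf : f.IsHomogeneous n) (h0 : dunklEuler N θ f = 0) : f = 0 := by
  refine eq_zero_of_smul_eq_smul_sum_permRep (a := ((n + θ / 2 * Fintype.card (Fin N × Fin N) : ℝ)))
    (b := (θ / 2 : ℝ)) ?_ (fun p : Fin N × Fin N => Equiv.swap p.1 p.2) ?_
  · rw [Complex.norm_of_nonneg (by positivity), Complex.norm_of_nonneg (by positivity)]
    exact lt_add_of_pos_left _ (by positivity)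
  · rw [dunklEuler_eq θ hf, Finset.sum_sub_distrib, Finset.sum_const, Finset.card_univ,
      ← Nat.cast_smul_eq_nsmul ℂ, smul_sub, smul_smul] at h0
    rw [← sub_eq_zero, ← h0]
    push_cast
    rw [add_smul]
    abel

theorem exists_dunklEuler_eq {θ : ℝ} (hθ : 0 ≤ θ) {n : ℕ} (hn : n ≠ 0) {f : Poly N}
    (hf : f.IsHomogeneous n) : ∃ g : Poly N, g.IsHomogeneous n ∧ dunklEuler N θ g = f := by
  have : FiniteDimensional ℂ (homogeneousSubmodule (Fin N) ℂ n) :=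
    Module.Finite.iff_fg.2 (homogeneousSubmodule_fg _ _ n)
  let e := (dunklEuler N θ).restrict (p := homogeneousSubmodule (Fin N) ℂ n)
    (q := homogeneousSubmodule (Fin N) ℂ n) fun f hf => isHomogeneous_dunklEuler θ hf
  have he : Function.Injective e := (injective_iff_map_eq_zero e).2 fun g hg =>
    Subtype.ext (eq_zero_of_dunklEuler_eq_zero hθ hn g.2 (congrArg Subtype.val hg))
  obtain ⟨g, hg⟩ := LinearMap.surjective_of_injective he ⟨f, hf⟩
  exact ⟨g, g.2, congrArg Subtype.val hg⟩

theorem dunklForm_dunklEuler_sub_swap (θ : ℝ) (i j : Fin N) (g : Poly N) :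
    dunklForm θ (dunklEuler N θ (g - permRep N (Equiv.swap i j) g))
        (g - permRep N (Equiv.swap i j) g) =
      2 * dunklForm θ (dunklEuler N θ g) (g - permRep N (Equiv.swap i j) g) := by
  simp only [map_sub, ← permRep_dunklEuler, LinearMap.sub_apply, dunklForm_permRep_swap,
    permRep_swap_self]
  ring

theorem re_dunklForm_dunklEuler_self_pos {θ : ℝ} {n : ℕ}
    (hpos : ∀ f : Poly N, f.IsHomogeneous n → f ≠ 0 → 0 < (dunklForm θ f f).re) {g : Poly N}
    (hg : g.IsHomogeneous (n + 1)) (h0 : dunklEuler N θ g ≠ 0) :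
    0 < (dunklForm θ (dunklEuler N θ g) g).re := by
  obtain ⟨i, hi⟩ : ∃ i, dunkl θ i g ≠ 0 := by
    by_contra! h
    exact h0 (by simp [dunklEuler_apply, h])
  rw [dunklForm_dunklEuler_left, Complex.re_sum]
  refine Finset.sum_pos' (fun j _ => ?_)
    ⟨i, Finset.mem_univ _, hpos _ (isHomogeneous_dunkl θ i hg) hi⟩
  rcases eq_or_ne (dunkl θ j g) 0 with h | h
  · simp [h]
  · exact (hpos _ (isHomogeneous_dunkl θ j hg) h).le

theorem re_dunklForm_dunklEuler_sub_swap_nonneg {θ : ℝ} {n : ℕ}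
    (hpos : ∀ f : Poly N, f.IsHomogeneous n → f ≠ 0 → 0 < (dunklForm θ f f).re) {g : Poly N}
    (hg : g.IsHomogeneous (n + 1)) (i j : Fin N) :
    0 ≤ (dunklForm θ (dunklEuler N θ g) (g - permRep N (Equiv.swap i j) g)).re := by
  have h : 0 ≤ (dunklForm θ (dunklEuler N θ (g - permRep N (Equiv.swap i j) g))
      (g - permRep N (Equiv.swap i j) g)).re := by
    rcases eq_or_ne (dunklEuler N θ (g - permRep N (Equiv.swap i j) g)) 0 with h | h
    · simp [h]
    · exact (re_dunklForm_dunklEuler_self_pos hpos (hg.sub hg.rename_isHomogeneous) h).le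
  rw [dunklForm_dunklEuler_sub_swap, ← Complex.ofReal_ofNat, Complex.re_ofReal_mul] at h
  exact nonneg_of_mul_nonneg_right h two_pos

-- Writing `f = E g` with `E = ∑ x_i D_i`, the two preceding lemmas bound the terms of
-- `⟨E g, E g⟩` obtained by applying `dunklEuler_eq` to its second argument.
theorem re_dunklForm_self_pos_of_isHomogeneous {θ : ℝ} (hθ : 0 ≤ θ) (n : ℕ) {f : Poly N}
    (hf : f.IsHomogeneous n) (h0 : f ≠ 0) : 0 < (dunklForm θ f f).re := by
  induction n generalizing f with
  | zero =>
    obtain ⟨c, rfl⟩ : ∃ c, f = C c := ⟨_, totalDegree_eq_zero_iff_eq_C.1 (hf.totalDegree h0)⟩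
    have hc : c ≠ 0 := fun h => h0 (by rw [h, map_zero])
    rw [dunklForm_C_left, constantCoeff_C, mul_comm, Complex.mul_conj, Complex.ofReal_re]
    exact Complex.normSq_pos.2 hc
  | succ n ih =>
    obtain ⟨g, hg, rfl⟩ := exists_dunklEuler_eq hθ n.succ_ne_zero hf
    have hexpand : dunklForm θ (dunklEuler N θ g) (dunklEuler N θ g) =
        ((n + 1 : ℝ) : ℂ) * dunklForm θ (dunklEuler N θ g) g + ((θ / 2 : ℝ) : ℂ) *
          ∑ p : Fin N × Fin N,
            dunklForm θ (dunklEuler N θ g) (g - permRep N (Equiv.swap p.1 p.2) g) := by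
      nth_rewrite 2 [dunklEuler_eq θ hg]
      rw [map_add, map_smul, map_smul, map_sum, smul_eq_mul, smul_eq_mul]
      push_cast
      rfl
    rw [hexpand, Complex.add_re, Complex.re_ofReal_mul, Complex.re_ofReal_mul, Complex.re_sum]
    have hpos := re_dunklForm_dunklEuler_self_pos (fun f hf h => ih hf h) hg h0
    have hnonneg := Finset.sum_nonneg fun (p : Fin N × Fin N) (_ : p ∈ Finset.univ) =>
      re_dunklForm_dunklEuler_sub_swap_nonneg (fun f hf h => ih hf h) hg p.1 p.2
    positivity

theorem dunklForm_self_eq_sum (θ : ℝ) (f : Poly N) :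
    dunklForm θ f f = ∑ n ∈ Finset.range (f.totalDegree + 1),
      dunklForm θ (homogeneousComponent n f) (homogeneousComponent n f) := by
  conv_lhs => rw [← sum_homogeneousComponent f]
  rw [map_sum]
  refine Finset.sum_congr rfl fun n hn => ?_
  rw [map_sum, LinearMap.sum_apply]
  exact Finset.sum_eq_single_of_mem n hn fun m _ hm =>
    dunklForm_eq_zero_of_ne θ hm (homogeneousComponent_isHomogeneous m f)
      (homogeneousComponent_isHomogeneous n f)

theorem re_dunklForm_self_pos {θ : ℝ} (hθ : 0 ≤ θ) {f : Poly N} (h0 : f ≠ 0) :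
    0 < (dunklForm θ f f).re := by
  have hpos : ∀ n, homogeneousComponent n f ≠ 0 →
      0 < (dunklForm θ (homogeneousComponent n f) (homogeneousComponent n f)).re := fun n hn =>
    re_dunklForm_self_pos_of_isHomogeneous hθ n (homogeneousComponent_isHomogeneous n f) hn
  obtain ⟨n, hn, hn0⟩ : ∃ n ∈ Finset.range (f.totalDegree + 1), homogeneousComponent n f ≠ 0 := by
    by_contra! h
    exact h0 (by rw [← sum_homogeneousComponent f, Finset.sum_eq_zero h])
  rw [dunklForm_self_eq_sum, Complex.re_sum]
  refine Finset.sum_pos' (fun m _ => ?_) ⟨n, hn, hpos n hn0⟩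
  rcases eq_or_ne (homogeneousComponent m f) 0 with h | h
  · simp [h]
  · exact (hpos m h).le

/-- The inner product on polynomials given by `dunklForm`, for which the operators `x_i D_i` are
symmetric. -/
abbrev dunklCore (N : ℕ) {θ : ℝ} (hθ : 0 ≤ θ) : InnerProductSpace.Core ℂ (Poly N) where
  inner f g := dunklForm θ f g
  conj_inner_symm := dunklForm_conj_symm θ
  re_inner_nonneg f := by
    rcases eq_or_ne f 0 with rfl | h
    · simp
    · exact (re_dunklForm_self_pos hθ h).le
  add_left f g h := by rw [map_add, LinearMap.add_apply]
  smul_left f g c := by rw [LinearMap.map_smulₛₗ, LinearMap.smul_apply, smul_eq_mul]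
  definite f hf := by
    by_contra h
    exact (re_dunklForm_self_pos hθ h).ne' (congrArg Complex.re hf)

/-! ### Leading parts -/

theorem V_eq_restrictSupport (l : PartLE N) : V l = restrictSupport ℂ {γ | sortDesc γ = l} := by
  rw [V, restrictSupport_eq_span]
  congr 1
  ext f
  simp only [Set.mem_ofPred_eq, Set.mem_image, eq_comm]

theorem mem_V {l : PartLE N} {f : Poly N} : f ∈ V l ↔ ∀ γ ∈ f.support, sortDesc γ = l := by
  rw [V_eq_restrictSupport]
  exact Iff.rfl

theorem V_le_lowerSpan (l : PartLE N) : V l ≤ lowerSpan l := fun _ hf =>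
  mem_lowerSpan.2 fun γ hγ => mem_V.1 hf γ hγ ▸ DomLE.refl _

theorem monomial_mem_V (γ : Fin N →₀ ℕ) (a : ℂ) : monomial γ a ∈ V (sortDesc γ) := by
  rw [V_eq_restrictSupport]
  exact (monomial_mem_restrictSupport ℂ).2 (Or.inl rfl)

theorem iSup_V : ⨆ l : PartLE N, V l = ⊤ := by
  refine eq_top_iff.2 fun f _ => ?_
  rw [f.as_sum]
  exact sum_mem fun γ _ => Submodule.mem_iSup_of_mem _ (monomial_mem_V γ _)

theorem iSupIndep_V : iSupIndep (V : PartLE N → Submodule ℂ (Poly N)) := by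
  intro l
  have hle : ⨆ (μ) (_ : μ ≠ l), V μ ≤ restrictSupport ℂ {γ | sortDesc γ ≠ l} :=
    iSup₂_le fun μ hμ f hf γ hγ => (mem_V.1 hf γ hγ).trans_ne hμ
  refine (Submodule.disjoint_def.2 fun f hf hf' => ?_).mono_right hle
  rw [← support_eq_empty, Finset.eq_empty_iff_forall_notMem]
  exact fun γ hγ => hf' hγ (mem_V.1 hf γ hγ)

theorem disjoint_V_strictLowerSpan (l : PartLE N) : Disjoint (V l) (strictLowerSpan l) := by
  refine Submodule.disjoint_def.2 fun f hf hf' => ?_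
  rw [← support_eq_empty, Finset.eq_empty_iff_forall_notMem]
  exact fun γ hγ => (mem_strictLowerSpan.1 hf' γ hγ).2 (mem_V.1 hf γ hγ)

theorem coeff_partIn (l : PartLE N) (f : Poly N) (γ : Fin N →₀ ℕ) [Decidable (sortDesc γ = l)] :
    coeff γ (partIn l f) = if sortDesc γ = l then coeff γ f else 0 := by
  classical
  rw [partIn, coeff_sum]
  simp only [coeff_monomial, Finset.sum_ite_eq', Finset.mem_filter, mem_support_iff]
  by_cases h : sortDesc γ = l <;> by_cases h' : coeff γ f = 0 <;> simp [h, h']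

/-- The map `partIn l` as a linear projection onto `V_λ`. -/
def partInₗ (l : PartLE N) : Poly N →ₗ[ℂ] Poly N where
  toFun := partIn l
  map_add' f g := by
    classical
    ext γ
    simp only [coeff_partIn, coeff_add]
    split_ifs <;> simp
  map_smul' c f := by
    classical
    ext γ
    simp only [coeff_partIn, coeff_smul, RingHom.id_apply]
    split_ifs <;> simp

theorem partInₗ_apply (l : PartLE N) (f : Poly N) : partInₗ l f = partIn l f := rfl

theorem partIn_mem_V (l : PartLE N) (f : Poly N) : partIn l f ∈ V l := by
  classical
  refine mem_V.2 fun γ hγ => ?_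
  rw [mem_support_iff, coeff_partIn] at hγ
  exact (ite_ne_right_iff.1 hγ).1

theorem sub_partIn_mem_strictLowerSpan {l : PartLE N} {f : Poly N} (hf : f ∈ lowerSpan l) :
    f - partIn l f ∈ strictLowerSpan l := by
  classical
  refine mem_strictLowerSpan.2 fun γ hγ => ?_
  rw [mem_support_iff, coeff_sub, coeff_partIn] at hγ
  split_ifs at hγ with h
  · exact absurd (sub_self _) hγ
  · exact ⟨mem_lowerSpan.1 hf γ (mem_support_iff.2 (by simpa only [sub_zero] using hγ)), h⟩

theorem mem_lowerSpan_of_sub_mem_strictLowerSpan {l : PartLE N} {f g : Poly N} (hg : g ∈ V l)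
    (h : f - g ∈ strictLowerSpan l) : f ∈ lowerSpan l := by
  simpa only [sub_add_cancel] using
    add_mem (strictLowerSpan_le_lowerSpan l h) (V_le_lowerSpan l hg)

theorem partIn_eq_of_sub_mem_strictLowerSpan {l : PartLE N} {f g : Poly N} (hg : g ∈ V l)
    (h : f - g ∈ strictLowerSpan l) : partIn l f = g := by
  refine sub_eq_zero.1 ((disjoint_V_strictLowerSpan l).le_bot
    ⟨sub_mem (partIn_mem_V l f) hg, ?_⟩)
  have := sub_mem h (sub_partIn_mem_strictLowerSpan
    (mem_lowerSpan_of_sub_mem_strictLowerSpan hg h))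
  rwa [sub_sub_sub_cancel_left] at this

theorem permRep_partIn (σ : Equiv.Perm (Fin N)) (l : PartLE N) (f : Poly N) :
    permRep N σ (partIn l f) = partIn l (permRep N σ f) := by
  classical
  ext γ
  simp only [coeff_partIn, coeff_permRep, sortDesc_mapDomain]

/-! ### Isotypic decomposition -/

section Module

variable {R M ι : Type*} [Ring R] [AddCommGroup M] [Module R M] {S : ι → Type*}
  [∀ i, AddCommGroup (S i)] [∀ i, Module R (S i)]

theorem iSupIndep_restrictScalars (A : Type*) [Semiring A] [Module A M] [SMul A R]
    [IsScalarTower A R M] {m : ι → Submodule R M} (hm : iSupIndep m) :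
    iSupIndep fun i => (m i).restrictScalars A := by
  intro i
  have := (disjoint_iff.1 (hm i))
  rw [disjoint_iff]
  simpa only [Submodule.restrictScalars_inf, Submodule.restrictScalars_iSup,
    Submodule.restrictScalars_bot] using congrArg (Submodule.restrictScalars A) this

theorem iSupIndep_isotypicComponent [∀ i, IsSimpleModule R (S i)]
    (hS : ∀ i j, Nonempty (S i ≃ₗ[R] S j) → i = j) :
    iSupIndep fun i => isotypicComponent R M (S i) := by
  intro i
  rw [disjoint_iff]
  by_contra hne
  have := IsSemisimpleModule.of_injective _ (Submodule.inclusion_injective (inf_le_left :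
    isotypicComponent R M (S i) ⊓ ⨆ (j) (_ : j ≠ i), isotypicComponent R M (S j) ≤ _))
  obtain ⟨T, hT, _⟩ := (IsSemisimpleModule.eq_bot_or_exists_simple_le _).resolve_left hne
  obtain ⟨e⟩ := isIsotypicOfType_submodule_iff.1
    (IsIsotypicOfType.isotypicComponent R M (S i)) T (hT.trans inf_le_left)
  have hle : T ≤ sSup {C | ∃ j, j ≠ i ∧ isotypicComponent R M (S j) = C} :=
    (hT.trans inf_le_right).trans (iSup₂_le fun j hj => le_sSup ⟨j, hj, rfl⟩)
  have hss : ∀ C : {C | ∃ j, j ≠ i ∧ isotypicComponent R M (S j) = C},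
      IsSemisimpleModule R C := by
    rintro ⟨_, j, _, rfl⟩
    infer_instance
  obtain ⟨_, ⟨j, hj, rfl⟩, T', hT', ⟨e'⟩⟩ := T.le_linearEquiv_of_le_sSup _ hle
  have := IsSimpleModule.congr e'.symm
  obtain ⟨e''⟩ := isIsotypicOfType_submodule_iff.1
    (IsIsotypicOfType.isotypicComponent R M (S j)) T' hT'
  exact hj (hS j i ⟨(e''.symm.trans e'.symm).trans e⟩)

theorem iSup_isotypicComponent [IsSemisimpleModule R M]
    (hS : ∀ (T : Submodule R M) [IsSimpleModule R T], ∃ i, Nonempty (T ≃ₗ[R] S i)) :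
    ⨆ i, isotypicComponent R M (S i) = ⊤ := by
  rw [eq_top_iff, ← IsSemisimpleModule.sSup_simples_eq_top]
  refine sSup_le fun T (hT : IsSimpleModule R T) => ?_
  obtain ⟨i, e⟩ := hS T
  exact le_iSup_of_le i (le_sSup e)

end Module

theorem iSupIndep_prod {α ι κ : Type*} [CompleteLattice α] [IsModularLattice α] {u : ι → α}
    {v : ι → κ → α} (hu : iSupIndep u) (hv : ∀ i, iSupIndep (v i)) (hle : ∀ i k, v i k ≤ u i) :
    iSupIndep fun p : ι × κ => v p.1 p.2 := by
  rintro ⟨i, k⟩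
  have hle' : ⨆ (q : ι × κ) (_ : q ≠ (i, k)), v q.1 q.2 ≤
      (⨆ (k') (_ : k' ≠ k), v i k') ⊔ ⨆ (i') (_ : i' ≠ i), u i' := by
    refine iSup₂_le fun ⟨i', k'⟩ hq => ?_
    rcases eq_or_ne i' i with rfl | hi
    · exact le_sup_of_le_left (le_iSup₂_of_le k' (fun h => hq (h ▸ rfl)) le_rfl)
    · exact le_sup_of_le_right (le_iSup₂_of_le i' hi (hle i' k'))
  exact ((hv i k).disjoint_sup_right_of_disjoint_sup_left
    ((hu i).mono_left (sup_le (hle i k) (iSup₂_le fun k' _ => hle i k')))).mono_right hle'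

section Rep

variable {A G W W' : Type*} [Field A] [Monoid G] [AddCommGroup W] [Module A W] [AddCommGroup W']
  [Module A W']

theorem nonempty_repEquiv_iff {ρ : Representation A G W} {σ : Representation A G W'} :
    Nonempty (ρ.Equiv σ) ↔ Nonempty (ρ.asModule ≃ₗ[A[G]] σ.asModule) := by
  constructor
  · rintro ⟨e⟩
    exact ⟨LinearEquiv.ofBijective
      (Representation.IntertwiningMap.equivLinearMapAsModule ρ σ e.toIntertwiningMap)
      e.toLinearEquiv.bijective⟩
  · rintro ⟨e⟩
    exact ⟨((Representation.IntertwiningMap.equivLinearMapAsModule ρ σ).symm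
      e.toLinearMap).ofBijective e.bijective⟩

/-- The `A[G]`-module of the representation attached to an `A[G]`-module `M` is again `M`. -/
def asModuleOfModuleEquiv (A G M : Type*) [CommSemiring A] [Monoid G] [AddCommMonoid M]
    [Module A M] [Module A[G] M] [IsScalarTower A A[G] M] :
    (Representation.ofModule' (k := A) (G := G) M).asModule ≃ₗ[A[G]] M where
  toAddEquiv := (Representation.asModuleEquiv _).toAddEquiv
  map_smul' r x := by
    change Representation.asModuleEquiv _ (r • x) = r • Representation.asModuleEquiv _ x
    rw [Representation.asModuleEquiv_map_smul, Representation.asAlgebraHom_def,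
      Representation.ofModule', Equiv.apply_symm_apply]
    rfl

end Rep

/-- The simple module over the group algebra attached to an isomorphism class of irreducible
representations. -/
abbrev IrrepClass.asModule (τ : IrrepClass N) : Type := (Quotient.out τ).rep.asModule

instance (τ : IrrepClass N) : IsSimpleModule ℂ[Equiv.Perm (Fin N)] τ.asModule :=
  (Representation.irreducible_iff_isSimpleModule_asModule _).1 (Quotient.out τ).irreducible

theorem IrrepClass.eq_of_linearEquiv (τ τ' : IrrepClass N)
    (h : Nonempty (τ.asModule ≃ₗ[ℂ[Equiv.Perm (Fin N)]] τ'.asModule)) : τ = τ' := by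
  rw [← Quotient.out_eq τ, ← Quotient.out_eq τ']
  exact Quotient.sound (nonempty_repEquiv_iff.2 h)

theorem IrrepClass.exists_linearEquiv (S : Type) [AddCommGroup S]
    [Module ℂ[Equiv.Perm (Fin N)] S] [IsSimpleModule ℂ[Equiv.Perm (Fin N)] S] :
    ∃ τ : IrrepClass N, Nonempty (S ≃ₗ[ℂ[Equiv.Perm (Fin N)]] τ.asModule) := by
  let _ : Module ℂ S := Module.compHom S (algebraMap ℂ ℂ[Equiv.Perm (Fin N)])
  have : IsScalarTower ℂ ℂ[Equiv.Perm (Fin N)] S := .of_compHom ..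
  let e := asModuleOfModuleEquiv ℂ (Equiv.Perm (Fin N)) S
  let T : Irrep N := ⟨S, Representation.ofModule' S,
    (Representation.irreducible_iff_isSimpleModule_asModule _).2 (.congr e)⟩
  obtain ⟨e'⟩ := nonempty_repEquiv_iff.1 (Quotient.mk_out (s := Irrep.setoid N) T)
  exact ⟨Quotient.mk _ T, ⟨e.symm.trans e'.symm⟩⟩

/-- The inclusion of `V_λ`, as a module over the group algebra, into the polynomials. -/
def VIncl (l : PartLE N) : (VRep l).toRepresentation.asModule →ₗ[ℂ] Poly N :=
  (VRep l).toSubmodule.subtype ∘ₗ (VRep l).toRepresentation.asModuleEquiv.toLinearMap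

theorem VIncl_injective (l : PartLE N) : Function.Injective (VIncl l) :=
  (VRep l).toSubmodule.subtype_injective.comp (VRep l).toRepresentation.asModuleEquiv.injective

theorem range_VIncl (l : PartLE N) : LinearMap.range (VIncl l) = V l := by
  rw [VIncl, LinearEquiv.range_comp, Submodule.range_subtype]
  rfl

theorem isotypic_eq_map (l : PartLE N) (τ : IrrepClass N) :
    isotypic l τ = ((isotypicComponent ℂ[Equiv.Perm (Fin N)] (VRep l).toRepresentation.asModule
      τ.asModule).restrictScalars ℂ).map (VIncl l) := rfl

theorem isotypic_le_V (l : PartLE N) (τ : IrrepClass N) : isotypic l τ ≤ V l := by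
  rw [isotypic_eq_map, ← range_VIncl]
  exact LinearMap.map_le_range

theorem map_mem_isotypic {l : PartLE N} {τ : IrrepClass N} (Q : Poly N →ₗ[ℂ] Poly N)
    (hV : ∀ f ∈ V l, Q f ∈ V l) (hQ : ∀ σ f, permRep N σ (Q f) = Q (permRep N σ f))
    {f : Poly N} (hf : f ∈ isotypic l τ) : Q f ∈ isotypic l τ := by
  rw [isotypic_eq_map] at hf ⊢
  obtain ⟨x, hx, rfl⟩ := hf
  let q : (VRep l).toRepresentation.IntertwiningMap (VRep l).toRepresentation :=
    ⟨Q.restrict hV, fun σ => LinearMap.ext fun x => Subtype.ext (hQ σ x).symm⟩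
  let q' : Module.End ℂ[Equiv.Perm (Fin N)] (VRep l).toRepresentation.asModule :=
    Representation.IntertwiningMap.equivLinearMapAsModule _ _ q
  have hq := Submodule.IsFullyInvariant.isotypicComponent
    ℂ[Equiv.Perm (Fin N)] (VRep l).toRepresentation.asModule τ.asModule q' hx
  exact ⟨q' x, hq, rfl⟩

theorem iSupIndep_isotypic (l : PartLE N) : iSupIndep (isotypic l) :=
  (VIncl l).iSupIndep_map (VIncl_injective l) (iSupIndep_restrictScalars ℂ
    (iSupIndep_isotypicComponent (M := (VRep l).toRepresentation.asModule)
      IrrepClass.eq_of_linearEquiv))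

theorem iSup_isotypic (l : PartLE N) : ⨆ τ, isotypic l τ = V l := by
  simp only [isotypic_eq_map, ← Submodule.map_iSup, ← Submodule.restrictScalars_iSup]
  rw [iSup_isotypicComponent (M := (VRep l).toRepresentation.asModule)
    fun T _ => IrrepClass.exists_linearEquiv T,
    Submodule.restrictScalars_top, Submodule.map_top, range_VIncl]

/-! ### Joint eigenbases -/

section Symmetric

variable {𝕜 E ι : Type*} [RCLike 𝕜] [NormedAddCommGroup E] [InnerProductSpace 𝕜 E]
  {T : ι → E →ₗ[𝕜] E}

theorem exists_joint_eigenbasis [FiniteDimensional 𝕜 E] (hT : ∀ j, (T j).IsSymmetric)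
    (hC : ∀ j k, Commute (T j) (T k)) :
    ∃ (b : Module.Basis (Fin (Module.finrank 𝕜 E)) 𝕜 E) (χ : Fin (Module.finrank 𝕜 E) → ι → 𝕜),
      ∀ i j, T j (b i) = χ i j • b i := by
  classical
  have hI := LinearMap.IsSymmetric.directSum_isInternal_of_pairwise_commute hT
    fun j k _ => hC j k
  let b := hI.collectedBasis fun χ => Module.finBasis 𝕜 _
  let e := b.indexEquiv (Module.finBasis 𝕜 E)
  refine ⟨b.reindex e, fun i => (e.symm i).1, fun i j => ?_⟩
  rw [Module.Basis.reindex_apply]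
  have := hI.collectedBasis_mem (fun χ => Module.finBasis 𝕜 _) (e.symm i)
  exact Module.End.mem_eigenspace_iff.1 (Submodule.mem_iInf _ |>.1 this j)

theorem exists_equiv_sup_inf_orthogonal {A K : Submodule 𝕜 E} [K.HasOrthogonalProjection]
    (hAK : Disjoint A K) :
    ∃ e : A ≃ₗ[𝕜] ((A ⊔ K) ⊓ Kᗮ : Submodule 𝕜 E), ∀ a, (e a : E) = a - K.starProjection a := by
  let p : A →ₗ[𝕜] ((A ⊔ K) ⊓ Kᗮ : Submodule 𝕜 E) :=
    ((LinearMap.id - K.starProjection.toLinearMap) ∘ₗ A.subtype).codRestrict _ fun a =>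
      ⟨sub_mem (Submodule.mem_sup_left a.2)
        (Submodule.mem_sup_right (K.starProjection_apply_mem a)),
        Submodule.sub_starProjection_mem_orthogonal (a : E)⟩
  have hp : ∀ a : A, (p a : E) = a - K.starProjection a := fun _ => rfl
  have hinj : Function.Injective p := by
    refine (injective_iff_map_eq_zero p).2 fun a ha => Subtype.ext ?_
    have haK : (a : E) = K.starProjection a := by
      rw [← sub_eq_zero, ← hp, ha, ZeroMemClass.coe_zero]
    exact hAK.le_bot ⟨a.2, haK ▸ K.starProjection_apply_mem a⟩
  have hsurj : Function.Surjective p := by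
    rintro ⟨w, hw, hwK⟩
    obtain ⟨a, ha, k, hk, rfl⟩ := Submodule.mem_sup.1 hw
    refine ⟨⟨a, ha⟩, Subtype.ext ?_⟩
    have h0 : K.starProjection a + k = 0 := by
      rw [← Submodule.starProjection_eq_self_iff.2 hk, ← map_add]
      exact (Submodule.starProjection_apply_eq_zero_iff K).2 hwK
    rw [hp, sub_eq_add_neg, neg_eq_of_add_eq_zero_right h0]
  exact ⟨LinearEquiv.ofBijective p ⟨hinj, hsurj⟩, hp⟩

-- The orthogonal complement of `K` in `A ⊔ K` is invariant under every `T j`, and it is a copy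
-- of `A` modulo `K`.
theorem exists_joint_eigenbasis_lift (hT : ∀ j, (T j).IsSymmetric)
    (hC : ∀ j k, Commute (T j) (T k)) {A K : Submodule 𝕜 E} [FiniteDimensional 𝕜 A]
    [K.HasOrthogonalProjection] (hAK : Disjoint A K) (hTA : ∀ j, ∀ x ∈ A, T j x ∈ A ⊔ K)
    (hTK : ∀ j, ∀ x ∈ K, T j x ∈ K) :
    ∃ (b : Module.Basis (Fin (Module.finrank 𝕜 A)) 𝕜 A) (F : Fin (Module.finrank 𝕜 A) → E)
      (χ : Fin (Module.finrank 𝕜 A) → ι → 𝕜),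
      (∀ i j, T j (F i) = χ i j • F i) ∧ ∀ i, F i - b i ∈ K := by
  let W : Submodule 𝕜 E := (A ⊔ K) ⊓ Kᗮ
  have hTW : ∀ j, ∀ x ∈ W, T j x ∈ W := by
    rintro j x ⟨hx, hxK⟩
    have hsup : A ⊔ K ≤ (A ⊔ K).comap (T j) :=
      sup_le (hTA j) fun y hy => Submodule.mem_sup_right (hTK j y hy)
    refine ⟨hsup hx, (Submodule.mem_orthogonal _ _).2 fun k hk => ?_⟩
    rw [← hT j k x]
    exact (Submodule.mem_orthogonal _ _).1 hxK _ (hTK j k hk)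
  obtain ⟨e, he⟩ := exists_equiv_sup_inf_orthogonal hAK
  have := Module.Finite.equiv e
  obtain ⟨b, χ, hb⟩ := exists_joint_eigenbasis (T := fun j => (T j).restrict (hTW j))
    (fun j => (hT j).restrict_invariant (hTW j))
    (fun j k => LinearMap.ext fun x => Subtype.ext (LinearMap.congr_fun (hC j k) x.1))
  let r := finCongr e.finrank_eq
  refine ⟨(b.map e.symm).reindex r.symm, fun i => b (r i), fun i => χ (r i),
    fun i j => congrArg Subtype.val (hb (r i) j), fun i => ?_⟩
  have hbi : (b (r i) : E) = e (e.symm (b (r i))) := by rw [e.apply_symm_apply]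
  simp only [Module.Basis.reindex_apply, Module.Basis.map_apply, Equiv.symm_symm]
  rw [hbi, he, sub_sub_cancel_left]
  exact neg_mem (K.starProjection_apply_mem _)

end Symmetric

theorem hpOp_mem_isotypic_sup (θ : ℝ) (m : ℕ) {l : PartLE N} {τ : IrrepClass N} {f : Poly N}
    (hf : f ∈ isotypic l τ) : hpOp N θ m f ∈ isotypic l τ ⊔ strictLowerSpan l := by
  have hlow : hpOp N θ m f ∈ lowerSpan l :=
    hpOp_mem_lowerSpan θ m (V_le_lowerSpan l (isotypic_le_V l τ hf))
  have hlead : partIn l (hpOp N θ m f) ∈ isotypic l τ :=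
    map_mem_isotypic (partInₗ l ∘ₗ hpOp N θ m) (fun f _ => partIn_mem_V l _)
      (fun σ f => by simp only [LinearMap.comp_apply, partInₗ_apply, permRep_partIn, permRep_hpOp])
      hf
  rw [← add_sub_cancel (partIn l (hpOp N θ m f)) (hpOp N θ m f)]
  exact Submodule.add_mem_sup hlead (sub_partIn_mem_strictLowerSpan hlow)

instance finiteDimensional_isotypic (l : PartLE N) (τ : IrrepClass N) :
    FiniteDimensional ℂ (isotypic l τ) :=
  Submodule.finiteDimensional_of_le ((isotypic_le_V l τ).trans (V_le_lowerSpan l))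

theorem exists_eigenfunctions {θ : ℝ} (hθ : 0 ≤ θ) (l : PartLE N) (τ : IrrepClass N) :
    ∃ (b : Module.Basis (Fin (Module.finrank ℂ (isotypic l τ))) ℂ (isotypic l τ))
      (F : Fin (Module.finrank ℂ (isotypic l τ)) → Poly N)
      (χ : Fin (Module.finrank ℂ (isotypic l τ)) → ℕ → ℂ),
      (∀ i m, hpOp N θ m (F i) = χ i m • F i) ∧ ∀ i, F i - b i ∈ strictLowerSpan l := by
  let _ : NormedAddCommGroup (Poly N) := (dunklCore N hθ).toNormedAddCommGroup
  let _ : InnerProductSpace ℂ (Poly N) := InnerProductSpace.ofCore (dunklCore N hθ).toCore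
  exact exists_joint_eigenbasis_lift (dunklForm_hpOp θ) (hpOp_commute N θ)
    ((disjoint_V_strictLowerSpan l).mono_left (isotypic_le_V l τ))
    (fun m _ => hpOp_mem_isotypic_sup θ m) (fun m _ => hpOp_mem_strictLowerSpan θ m)

/-! ### The basis of eigenfunctions -/

/-- A label is a pair `(λ, τ)` together with an index below the dimension of the
`τ`-isotypic component of `V_λ`. -/
def labelEquiv (N : ℕ) : Label N ≃
    Σ p : PartLE N × IrrepClass N, Fin (Module.finrank ℂ (isotypic p.1 p.2)) where
  toFun t := ⟨(t.part, t.irr), t.idx⟩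
  invFun x := ⟨x.1.1, x.1.2, x.2⟩
  left_inv _ := rfl
  right_inv _ := rfl

open Classical in
theorem isInternal_isotypic :
    DirectSum.IsInternal fun p : PartLE N × IrrepClass N => isotypic p.1 p.2 := by
  refine (DirectSum.isInternal_submodule_iff_iSupIndep_and_iSup_eq_top _).2
    ⟨iSupIndep_prod iSupIndep_V iSupIndep_isotypic isotypic_le_V, ?_⟩
  rw [iSup_prod]
  simp only [iSup_isotypic, iSup_V]

section LabelBasis

variable (b : ∀ (l : PartLE N) (τ : IrrepClass N),
  Module.Basis (Fin (Module.finrank ℂ (isotypic l τ))) ℂ (isotypic l τ))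

open Classical in
/-- The basis of the polynomial ring collected from bases of the isotypic components of all
the spaces `V_λ`. -/
def labelBasis : Module.Basis (Label N) ℂ (Poly N) :=
  (isInternal_isotypic.collectedBasis fun p => b p.1 p.2).reindex (labelEquiv N).symm

theorem labelBasis_apply (t : Label N) : labelBasis b t = b t.part t.irr t.idx := by
  classical
  rw [labelBasis, Module.Basis.reindex_apply, DirectSum.IsInternal.collectedBasis_coe]
  rfl

theorem V_le_span_labelBasis (l : PartLE N) :
    V l ≤ Submodule.span ℂ (labelBasis b '' {t | t.part = l}) := by
  rw [← iSup_isotypic l]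
  refine iSup_le fun τ f hf => ?_
  have hmem : ∀ i, (b l τ i : Poly N) ∈ Submodule.span ℂ (labelBasis b '' {t | t.part = l}) :=
    fun i => Submodule.subset_span ⟨⟨l, τ, i⟩, rfl, labelBasis_apply b _⟩
  lift f to isotypic l τ using hf
  rw [← (b l τ).sum_repr f, AddSubmonoidClass.coe_finsetSum]
  exact sum_mem fun i _ => Submodule.smul_mem _ _ (hmem i)

theorem strictLowerSpan_le_span_labelBasis (l : PartLE N) :
    strictLowerSpan l ≤ Submodule.span ℂ (labelBasis b '' {t | t.part.rank < l.rank}) := by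
  intro f hf
  rw [f.as_sum]
  refine sum_mem fun γ hγ => ?_
  obtain ⟨hle, hne⟩ := mem_strictLowerSpan.1 hf γ hγ
  have hlt : {t : Label N | t.part = sortDesc γ} ⊆ {t | t.part.rank < l.rank} := by
    intro t ht
    rw [Set.mem_ofPred_eq] at ht ⊢
    exact ht ▸ hle.rank_lt hne
  exact Submodule.span_mono (Set.image_mono hlt)
    (V_le_span_labelBasis b _ (monomial_mem_V γ (coeff γ f)))

end LabelBasis

section Triangular

variable {R M ι : Type*} [Ring R] [AddCommGroup M] [Module R M]

theorem mem_span_of_triangular {b F : ι → M} (r : ι → ℕ)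
    (h : ∀ t, F t - b t ∈ Submodule.span R (b '' {s | r s < r t})) (t : ι) :
    b t ∈ Submodule.span R (Set.range F) := by
  induction hn : r t using Nat.strong_induction_on generalizing t with
  | _ n ih =>
    have hle : Submodule.span R (b '' {s | r s < r t}) ≤ Submodule.span R (Set.range F) := by
      rw [Submodule.span_le]
      rintro _ ⟨s, hs, rfl⟩
      exact ih (r s) (hn ▸ hs) s rfl
    have hsub := sub_mem (Submodule.subset_span (Set.mem_range_self t)) (hle (h t))
    rwa [sub_sub_cancel] at hsub

theorem repr_of_triangular (b : Module.Basis ι R M) {F : ι → M} (r : ι → ℕ)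
    (h : ∀ t, F t - b t ∈ Submodule.span R (b '' {s | r s < r t})) {s t : ι} (hst : r s ≤ r t) :
    b.repr (F s) t = Finsupp.single s 1 t := by
  have h0 : b.repr (F s - b s) t = 0 := by
    by_contra hne
    exact (b.repr_support_subset_of_mem_span _ (h s) (Finsupp.mem_support_iff.2 hne)).not_ge hst
  rwa [map_sub, Finsupp.sub_apply, b.repr_self, sub_eq_zero] at h0

theorem linearIndependent_of_triangular (b : Module.Basis ι R M) {F : ι → M} (r : ι → ℕ)
    (h : ∀ t, F t - b t ∈ Submodule.span R (b '' {s | r s < r t})) : LinearIndependent R F := by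
  classical
  rw [linearIndependent_iff']
  intro s c hc
  by_contra! hne
  obtain ⟨i, hi, hci⟩ := hne
  obtain ⟨t, ht, hmax⟩ := (s.filter (c · ≠ 0)).exists_max_image r
    ⟨i, Finset.mem_filter.2 ⟨hi, hci⟩⟩
  obtain ⟨hts, hct⟩ := Finset.mem_filter.1 ht
  have hcoord : ∑ j ∈ s, c j * b.repr (F j) t = 0 := by
    simpa only [map_sum, map_smul, Finsupp.finsetSum_apply, Finsupp.smul_apply, map_zero,
      Finsupp.zero_apply, smul_eq_mul] using congrArg (fun x => b.repr x t) hc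
  rw [Finset.sum_eq_single_of_mem t hts, repr_of_triangular b r h le_rfl, Finsupp.single_eq_same,
    mul_one] at hcoord
  · exact hct hcoord
  · intro j hj hjt
    by_cases hcj : c j = 0
    · rw [hcj, zero_mul]
    · rw [repr_of_triangular b r h (hmax j (Finset.mem_filter.2 ⟨hj, hcj⟩)),
        Finsupp.single_eq_of_ne hjt.symm, mul_zero]

theorem exists_basis_of_triangular (b : Module.Basis ι R M) {F : ι → M} (r : ι → ℕ)
    (h : ∀ t, F t - b t ∈ Submodule.span R (b '' {s | r s < r t})) :
    ∃ B : Module.Basis ι R M, ⇑B = F := by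
  refine ⟨.mk (linearIndependent_of_triangular b r h) ?_, Module.Basis.coe_mk _ _⟩
  rw [← b.span_eq, Submodule.span_le]
  rintro _ ⟨t, rfl⟩
  exact mem_span_of_triangular r h t

end Triangular

theorem mem_span_of_eigenvector {R M ι κ : Type*} [CommRing R] [IsDomain R] [AddCommGroup M]
    [Module R M] (B : Module.Basis ι R M) {T : κ → Module.End R M} {χ : ι → κ → R}
    (hB : ∀ t m, T m (B t) = χ t m • B t) {S : Set κ} {c : κ → R} {G : M}
    (hG : ∀ m ∈ S, T m G = c m • G) :
    G ∈ Submodule.span R (B '' {t | ∀ m ∈ S, χ t m = c m}) := by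
  rw [B.mem_span_image]
  intro t ht m hm
  have hcoord : B.coord t ∘ₗ T m = χ t m • B.coord t := by
    refine B.ext fun s => ?_
    simp only [LinearMap.comp_apply, hB, map_smul, LinearMap.smul_apply, B.coord_apply,
      B.repr_self, smul_eq_mul]
    rcases eq_or_ne s t with rfl | hst
    · rfl
    · rw [Finsupp.smul_apply, Finsupp.single_eq_of_ne hst.symm, smul_zero, mul_zero]
  have hGt : c m * B.repr G t = χ t m * B.repr G t := by
    simpa only [LinearMap.comp_apply, hG m hm, map_smul, LinearMap.smul_apply, B.coord_apply,
      Finsupp.smul_apply, smul_eq_mul] using LinearMap.congr_fun hcoord G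
  exact (mul_right_cancel₀ (Finsupp.mem_support_iff.1 ht) hGt).symm

theorem exists_eigenbasis {θ : ℝ} (hθ : 0 ≤ θ) :
    ∃ (b F : Module.Basis (Label N) ℂ (Poly N)) (χ : Label N → ℕ → ℂ),
      (∀ t, b t ∈ isotypic t.part t.irr) ∧ (∀ t m, hpOp N θ m (F t) = χ t m • F t) ∧
        ∀ t, F t - b t ∈ strictLowerSpan t.part := by
  choose b F χ hχ hF using fun l τ => exists_eigenfunctions (N := N) hθ l τ
  have hsub : ∀ t : Label N, F t.part t.irr t.idx - labelBasis b t ∈ strictLowerSpan t.part :=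
    fun t => labelBasis_apply b t ▸ hF t.part t.irr t.idx
  obtain ⟨B, hB⟩ := exists_basis_of_triangular (labelBasis b) (fun t => t.part.rank)
    fun t => strictLowerSpan_le_span_labelBasis b t.part (hsub t)
  refine ⟨labelBasis b, B, fun t => χ t.part t.irr t.idx, fun t => ?_, fun t => ?_, fun t => ?_⟩
  · exact labelBasis_apply b t ▸ (b t.part t.irr t.idx).2
  · exact hB ▸ hχ t.part t.irr t.idx
  · exact hB ▸ hsub t

end HeckmanPolychronakos

end

open HeckmanPolychronakos in
theorem theorem4p2 (N : ℕ) (hN : 1 ≤ N) (θ : ℝ) (hθ : 0 < θ) :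
    ∃ (F : HeckmanPolychronakos.Label N → MvPolynomial (Fin N) ℂ)
      (eig : HeckmanPolychronakos.Label N → ℕ → ℂ),
      -- each `F_{λ,τ,i}` is a joint eigenfunction of all `P_m`, `m ≥ 1`, with eigenvalues `eig`
      (∀ t, ∀ m ≥ 1, (HeckmanPolychronakos.hpOp N θ m).HasEigenvector (eig t m) (F t)) ∧
      (∀ t, (F t).IsHomogeneous t.part.size) ∧
      (∀ t, ∀ γ ∈ (F t).support,
        HeckmanPolychronakos.DomLE (HeckmanPolychronakos.sortDesc γ) t.part) ∧
      (∀ t, HeckmanPolychronakos.partIn t.part (F t) ∈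
        HeckmanPolychronakos.isotypic t.part t.irr) ∧
      -- the functions form a basis of the space of all polynomials
      LinearIndependent ℂ F ∧
      Submodule.span ℂ (Set.range F) = ⊤ ∧
      -- every joint eigenfunction, and every eigenfunction of a single `P_m`, is a linear
      -- combination of those `F_{λ,τ,i}` that have the same eigenvalue(s)
      (∀ (c : ℕ → ℂ) (G : MvPolynomial (Fin N) ℂ),
        (∀ m ≥ 1, (HeckmanPolychronakos.hpOp N θ m).HasEigenvector (c m) G) →
          G ∈ Submodule.span ℂ (F '' {t | ∀ m ≥ 1, eig t m = c m})) ∧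
      (∀ m ≥ 1, ∀ (c : ℂ) (G : MvPolynomial (Fin N) ℂ),
        (HeckmanPolychronakos.hpOp N θ m).HasEigenvector c G →
          G ∈ Submodule.span ℂ (F '' {t | eig t m = c})) := by
  obtain ⟨b, F, χ, hb, hχ, hsub⟩ := exists_eigenbasis (N := N) hθ.le
  have hbV : ∀ t, b t ∈ V t.part := fun t => isotypic_le_V _ _ (hb t)
  have hlow : ∀ t, F t ∈ lowerSpan t.part := fun t =>
    mem_lowerSpan_of_sub_mem_strictLowerSpan (hbV t) (hsub t)
  have hlead : ∀ t, partIn t.part (F t) = b t := fun t =>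
    partIn_eq_of_sub_mem_strictLowerSpan (hbV t) (hsub t)
  refine ⟨F, χ, fun t m _ => ⟨Module.End.mem_eigenspace_iff.2 (hχ t m), F.ne_zero t⟩,
    fun t => isHomogeneous_of_mem_lowerSpan (hlow t), fun t => mem_lowerSpan.1 (hlow t),
    fun t => hlead t ▸ hb t, F.linearIndependent, F.span_eq, fun c G hG => ?_,
    fun m _ c G hG => ?_⟩
  · exact mem_span_of_eigenvector F hχ (S := {m | m ≥ 1}) fun m hm => (hG m hm).apply_eq_smul
  · simpa only [Set.mem_singleton_iff, forall_eq] using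
      mem_span_of_eigenvector F hχ (S := {m}) (c := fun _ => c)
        fun k hk => hk ▸ hG.apply_eq_smul
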